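/- **Setting.** Let $k\ge 0$ and let $(\Lambda,d)$ be a $k$-graph: a countable category $\Lambda$ with a functor $d:\Lambda\to\mathbb N^k$ such that whenever $d(\lambda)=m+n$ there are unique $\mu,\nu$ with $\lambda=\mu\nu$, $d(\mu)=m$, $d(\nu)=n$. Write $r(\lambda),s(\lambda)$ for the range and source (so $\mu\nu$ is defined when $s(\mu)=r(\nu)$), and $v\Lambda=\{\lambda : r(\lambda)=v\}$ for an object $v$. For $\lambda,\mu\in\Lambda$ let $\Lambda^{\min}(\lambda,\mu)$ be the set of pairs $(\alpha,\beta)$ with $\lambda\alpha=\mu\beta$ and $d(\lambda\alpha)=d(\lambda)\vee d(\mu)$. Assume that $\Lambda$ is finitely aligned, i.e. every $\Lambda^{\min}(\lambda,\mu)$ is finite. A set $E\subseteq v\Lambda$ is exhaustive if for every $\mu\in v\Lambda$ there is $\lambda\in E$ with $\Lambda^{\min}(\lambda,\mu)\neq\emptyset$. For $m\in(\mathbb N\cup\{\infty\})^k$ let $\Omega_{k,m}$ be the category with objects $\{p\in\mathbb N^k : p\le m\}$ and exactly one morphism $(p,q)$, with range $p$, source $q$ and degree $q-p$, whenever $p\le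 q$. The boundary-path space $\partial\Lambda$ is the set of degree-preserving functors $x:\Omega_{k,m}\to\Lambda$ (with $m=:d(x)$ arbitrary) such that for all $n\in\mathbb N^k$ with $n\le d(x)$ and every finite exhaustive $E\subseteq x(n)\Lambda$ there is $\lambda\in E$ with $d(\lambda)\le d(x)-n$ and $x(n,n+d(\lambda))=\lambda$. Put $D_\lambda=\{x\in\partial\Lambda : d(x)\ge d(\lambda),\ x(0,d(\lambda))=\lambda\}$, and give $\partial\Lambda$ the topology generated by the sets $D_\lambda\setminus\bigcup_{\nu\in F}D_{\lambda\nu}$ with $\lambda\in\Lambda$ and $F\subseteq s(\lambda)\Lambda$ finite. For $n\in\mathbb N^k$ let $\partial\Lambda^{\ge n}=\{x\in\partial\Lambda : d(x)\ge n\}$, with the subspace topology, and let $\sigma_n:\partial\Lambda^{\ge n}\to\partial\Lambda$ be the shift $\sigma_n(x)(p,q)=x(p+n,q+n)$, $d(\sigma_n(x))=d(x)-n$. Let $A=C_0(\partial\Lambda)$. Let $X_n$ be the Hilbert $A$-bimodule obtained by completing $C_c(\partial\Lambda^{\ge n})$ for $$\langle f,g\rangle_n(x)=\sum_{\sigma_n(y)=x}\overline{f(y)}\,g(y),\qquad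 (f\cdot a)(x)=f(x)\,a(\sigma_n(x)),\qquad (a\cdot f)(x)=a(x)f(x)$$ (so $X_n=\{0\}$ if $\partial\Lambda^{\ge n}=\emptyset$). **Proposition.** (1) For all $m,n\in\mathbb N^k$ the map $$\pi:C_c(\partial\Lambda^{\ge m})\times C_c(\partial\Lambda^{\ge n})\to C_c(\partial\Lambda^{\ge m+n}),\qquad \pi(f,g)(x)=f(x)\,g(\sigma_m(x)),$$ is surjective, and it induces an isomorphism of Hilbert $A$-bimodules $\pi_{m,n}:X_m\otimes_A X_n\to X_{m+n}$ satisfying $\pi_{m,n}(f\otimes g)=f\,(g\circ\sigma_m)$ for $f\in C_c(\partial\Lambda^{\ge m})$, $g\in C_c(\partial\Lambda^{\ge n})$. Here $X_m\otimes_A X_n$ is the internal (balanced) tensor product of Hilbert bimodules, with $\langle x\otimes y,x'\otimes y'\rangle=\langle y,\langle x,x'\rangle\cdot y'\rangle$. (2) With the multiplication $xy:=\pi_{m,n}(x\otimes y)$ for $x\in X_m$, $y\in X_n$, the disjoint union $X=\bigsqcup_{n\in\mathbb N^k}X_n$ is a product system of Hilbert $A$-bimodules over $\mathbb N^k$. That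 is: the multiplication is associative; for all $m,n\in\mathbb N^k$ the map $x\otimes y\mapsto xy$ is an isomorphism $X_m\otimes_A X_n\cong X_{m+n}$ of Hilbert $A$-bimodules; and there is an isomorphism of Hilbert $A$-bimodules $A\cong X_0$, which sends each $a\in C_c(\partial\Lambda)$ to the same function regarded as an element of $C_c(\partial\Lambda^{\ge 0})=C_c(\partial\Lambda)$, such that, identifying $A$ with $X_0$ through it, $ax=a\cdot x$ and $xa=x\cdot a$ for all $a\in A$, $n\in\mathbb N^k$ and $x\in X_n$. -/

import Mathlib

open CategoryTheory
open scoped TensorProduct ComplexConjugate CompactlySupported ZeroAtInfty ComplexOrder Topology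

universe u v w

/-- A pre-Hilbert `A`-bimodule structure on a complex vector space `T`, for a (not necessarily
unital) `C⋆`-algebra `A`: an `A`-valued inner product `inner` (conjugate-linear in the first and
linear in the second variable, hermitian, positive), a right action `right a x = x · a` compatible
with the inner product, and a left action `left a x = a · x` by adjointable operators. An element
of `A` is positive when it has the form `b⋆ b`. -/
structure PreHilbertBimodule (A : Type u) [NonUnitalCStarAlgebra A] (T : Type v)
    [AddCommGroup T] [Module ℂ T] where
  inner : T →ₗ⋆[ℂ] T →ₗ[ℂ] A
  right : A →ₗ[ℂ] T →ₗ[ℂ] T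
  left : A →ₗ[ℂ] T →ₗ[ℂ] T
  star_inner : ∀ x y, star (inner x y) = inner y x
  inner_self : ∀ x, ∃ b, inner x x = star b * b
  inner_right : ∀ x y a, inner x (right a y) = inner x y * a
  right_mul : ∀ a b x, right (a * b) x = right b (right a x)
  left_mul : ∀ a b x, left (a * b) x = left a (left b x)
  inner_left : ∀ a x y, inner (left a x) y = inner x (left (star a) y)
  left_right : ∀ a b x, left a (right b x) = right b (left a x)

namespace PreHilbertBimodule

theorem left_bound_aux {A : Type u} [NonUnitalCStarAlgebra A] (b : A) [PartialOrder A] [StarOrderedRing A] (hb : 0 ≤ b) (h1 : ‖b‖ ≤ 1) :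
    ∃ d : A, star d = d ∧ d + d - d * d = b := by
  refine ⟨cfcₙ (fun t : ℝ => 1 - √(1 - t)) b, ?_, ?_⟩
  · exact (IsSelfAdjoint.cfcₙ).star_eq
  · have hsa : IsSelfAdjoint b := IsSelfAdjoint.of_nonneg hb
    rw [← cfcₙ_mul (fun t : ℝ => 1 - √(1 - t)) (fun t : ℝ => 1 - √(1 - t)) b,
      ← cfcₙ_add .., ← cfcₙ_sub ..]
    conv_rhs => rw [← cfcₙ_id ℝ b]
    refine cfcₙ_congr ?_
    intro t ht
    have ht1 : t ≤ 1 := by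
      have := NonUnitalIsometricContinuousFunctionalCalculus.norm_quasispectrum_le (𝕜 := ℝ) b ht
      exact (le_abs_self t).trans (this.trans h1)
    have : √(1 - t) * √(1 - t) = 1 - t := Real.mul_self_sqrt (by linarith)
    simp only [id]
    linarith [this]

section Basic
variable {A : Type u} [NonUnitalCStarAlgebra A] {T : Type v} [AddCommGroup T] [Module ℂ T]
  (P : PreHilbertBimodule A T)

theorem inner_right_left (x y : T) (a : A) : P.inner (P.right a x) y = star a * P.inner x y := by
  rw [← P.star_inner, P.inner_right, star_mul, P.star_inner]

theorem inner_nonneg [PartialOrder A] [StarOrderedRing A] (x : T) : 0 ≤ P.inner x x := by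
  obtain ⟨b, hb⟩ := P.inner_self x
  rw [hb]; exact star_mul_self_nonneg b

theorem cauchy_schwarz_aux (x y : T) (r : ℝ) (hr : 0 < r) (hx : ‖P.inner x x‖ ≤ r) :
    ‖P.inner x y‖ ^ 2 ≤ r * ‖P.inner y y‖ := by
  let _ := CStarAlgebra.spectralOrder A
  have _ := CStarAlgebra.spectralOrderedRing A
  set a := P.inner x y with ha
  have hsa : IsSelfAdjoint (P.inner x x) := P.star_inner x x
  have h2 : star a * P.inner x x * a ≤ r • (star a * a) :=
    (CStarAlgebra.star_left_conjugate_le_norm_smul).trans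
      (smul_le_smul_of_nonneg_right hx (star_mul_self_nonneg a))
  have h0 := P.inner_nonneg ((r : ℂ) • y - P.right a x)
  have key : P.inner ((r : ℂ) • y - P.right a x) ((r : ℂ) • y - P.right a x)
      = (r * r) • P.inner y y - (2 * r) • (star a * a) + star a * P.inner x x * a := by
    simp only [map_sub, map_smul, LinearMap.sub_apply, LinearMap.smul_apply, map_smulₛₗ,
      P.inner_right, P.inner_right_left, ← ha, Complex.conj_ofReal, smul_sub]
    rw [show P.inner y x = star a by rw [ha, P.star_inner]]
    simp only [two_mul, add_smul, mul_smul, Complex.coe_smul]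
    abel
  rw [key] at h0
  have h3 : star a * a ≤ r • P.inner y y := by
    have : r • (star a * a) ≤ r • (r • P.inner y y) := by
      have := h0.trans (add_le_add_right h2 _)
      rw [two_mul, add_smul, mul_smul] at this
      rw [← sub_nonneg]
      convert this using 1
      abel
    exact (smul_le_smul_iff_of_pos_left hr).mp this
  calc ‖a‖ ^ 2 = ‖star a * a‖ := by rw [CStarRing.norm_star_mul_self, sq]
    _ ≤ ‖r • P.inner y y‖ := CStarAlgebra.norm_le_norm_of_nonneg_of_le (star_mul_self_nonneg a) h3
    _ = r * ‖P.inner y y‖ := by rw [norm_smul, Real.norm_of_nonneg hr.le]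

theorem cauchy_schwarz (x y : T) :
    ‖P.inner x y‖ ≤ √‖P.inner x x‖ * √‖P.inner y y‖ := by
  rw [← Real.sqrt_mul (norm_nonneg _)]
  refine Real.le_sqrt_of_sq_le ?_
  refine le_of_forall_pos_le_add fun ε hε => ?_
  set N := ‖P.inner y y‖
  have hN : 0 ≤ N := norm_nonneg _
  have := P.cauchy_schwarz_aux x y (‖P.inner x x‖ + ε / (N + 1)) (by positivity)
    (by have : 0 < ε / (N + 1) := by positivity
        linarith)
  refine this.trans ?_
  rw [add_mul]
  have : ε / (N + 1) * N ≤ ε := by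
    rw [div_mul_eq_mul_div, div_le_iff₀ (by positivity)]
    nlinarith
  linarith

theorem sqrt_inner_smul (c : ℂ) (x : T) :
    √‖P.inner (c • x) (c • x)‖ = ‖c‖ * √‖P.inner x x‖ := by
  have : P.inner (c • x) (c • x) = (conj c * c) • P.inner x x := by
    simp [smul_smul, mul_comm]
  rw [this, norm_smul, norm_mul, RCLike.norm_conj, ← sq, Real.sqrt_mul (sq_nonneg _),
    Real.sqrt_sq (norm_nonneg _)]

theorem sqrt_inner_add (x y : T) :
    √‖P.inner (x + y) (x + y)‖ ≤ √‖P.inner x x‖ + √‖P.inner y y‖ := by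
  have h1 := P.cauchy_schwarz x y
  have h2 := P.cauchy_schwarz y x
  have e : P.inner (x + y) (x + y)
      = P.inner x x + P.inner x y + (P.inner y x + P.inner y y) := by
    simp only [map_add, LinearMap.add_apply]; abel
  have hx := Real.sq_sqrt (norm_nonneg (P.inner x x))
  have hy := Real.sq_sqrt (norm_nonneg (P.inner y y))
  refine Real.sqrt_le_iff.mpr ⟨add_nonneg (Real.sqrt_nonneg _) (Real.sqrt_nonneg _), ?_⟩
  rw [e]
  refine (norm_add_le _ _).trans ((add_le_add (norm_add_le _ _) (norm_add_le _ _)).trans ?_)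
  nlinarith

theorem sqrt_inner_right_le (a : A) (x : T) :
    √‖P.inner (P.right a x) (P.right a x)‖ ≤ ‖a‖ * √‖P.inner x x‖ := by
  refine Real.sqrt_le_iff.mpr ⟨by positivity, ?_⟩
  rw [P.inner_right, P.inner_right_left, mul_pow, Real.sq_sqrt (norm_nonneg _)]
  refine (norm_mul_le _ _).trans ((mul_le_mul_of_nonneg_right (norm_mul_le _ _) (norm_nonneg _)).trans
    (le_of_eq ?_))
  rw [norm_star]; ring

theorem inner_left_self_le [PartialOrder A] [StarOrderedRing A] (a : A) (x : T) :
    P.inner (P.left a x) (P.left a x) ≤ (‖a‖ ^ 2) • P.inner x x := by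
  by_cases ha : a = 0
  · simp [ha]
  have hn : 0 < ‖a‖ := norm_pos_iff.mpr ha
  set t : ℝ := (‖a‖ ^ 2)⁻¹
  have ht : 0 < t := by positivity
  have hb : 0 ≤ t • (star a * a) := smul_nonneg ht.le (star_mul_self_nonneg a)
  obtain ⟨d, hd, hdb⟩ := left_bound_aux (t • (star a * a)) hb (by
    rw [norm_smul, CStarRing.norm_star_mul_self, Real.norm_of_nonneg ht.le]
    simp only [t]; rw [← sq, inv_mul_cancel₀ (by positivity)])
  have h0 := P.inner_nonneg (x - P.left d x)
  have key : P.inner (x - P.left d x) (x - P.left d x)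
      = P.inner x x - t • P.inner (P.left a x) (P.left a x) := by
    have e1 : P.inner (P.left a x) (P.left a x) = P.inner x (P.left (star a * a) x) := by
      rw [P.inner_left, P.left_mul]
    have e2 : t • P.inner x (P.left (star a * a) x) = P.inner x (P.left (t • (star a * a)) x) := by
      rw [← Complex.coe_smul, ← Complex.coe_smul]
      simp
    rw [e1, e2, ← hdb]
    simp only [map_sub, map_add, LinearMap.sub_apply, LinearMap.add_apply, P.inner_left, hd,
      P.left_mul]
    abel
  rw [key, sub_nonneg] at h0
  have := smul_le_smul_of_nonneg_left h0 (sq_nonneg ‖a‖)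
  rwa [smul_smul, mul_inv_cancel₀ (by positivity), one_smul] at this

theorem sqrt_inner_left_le (a : A) (x : T) :
    √‖P.inner (P.left a x) (P.left a x)‖ ≤ ‖a‖ * √‖P.inner x x‖ := by
  let _ := CStarAlgebra.spectralOrder A
  have _ := CStarAlgebra.spectralOrderedRing A
  refine Real.sqrt_le_iff.mpr ⟨by positivity, ?_⟩
  rw [mul_pow, Real.sq_sqrt (norm_nonneg _)]
  refine (CStarAlgebra.norm_le_norm_of_nonneg_of_le (P.inner_nonneg _)
    (P.inner_left_self_le a x)).trans (le_of_eq ?_)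
  rw [norm_smul, Real.norm_of_nonneg (sq_nonneg _)]

/-- The space `T` with the seminorm `‖x‖ = ‖⟨x, x⟩‖ ^ (1/2)`. -/
def Space (_P : PreHilbertBimodule A T) : Type v := T

noncomputable instance : SeminormedAddCommGroup P.Space :=
  @SeminormedAddCommGroup.ofCore ℂ T _ _ ⟨fun x => √‖P.inner x x‖⟩ _
    (@SeminormedSpace.Core.mk ℂ T _ _ ⟨fun x => √‖P.inner x x‖⟩ _
      (fun _ => Real.sqrt_nonneg _) P.sqrt_inner_smul P.sqrt_inner_add)

instance : Module ℂ P.Space := inferInstanceAs (Module ℂ T)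

noncomputable instance : NormedSpace ℂ P.Space where
  norm_smul_le c x := (P.sqrt_inner_smul c x).le

/-- The same structure, viewed on the seminormed space. -/
def onSpace : PreHilbertBimodule A P.Space := P

theorem norm_space (x : P.Space) : ‖x‖ = √‖P.onSpace.inner x x‖ := rfl

/-- The inner product as a continuous sesquilinear map. -/
noncomputable def innerL : P.Space →L⋆[ℂ] P.Space →L[ℂ] A :=
  P.onSpace.inner.mkContinuous₂ 1 (fun x y => by
    rw [one_mul, norm_space, norm_space]; exact P.cauchy_schwarz x y)

/-- The right action as a continuous bilinear map. -/
noncomputable def rightL : A →L[ℂ] P.Space →L[ℂ] P.Space :=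
  P.onSpace.right.mkContinuous₂ 1 (fun a x => by
    rw [one_mul, norm_space, norm_space]; exact P.sqrt_inner_right_le a x)

/-- The left action as a continuous bilinear map. -/
noncomputable def leftL : A →L[ℂ] P.Space →L[ℂ] P.Space :=
  P.onSpace.left.mkContinuous₂ 1 (fun a x => by
    rw [one_mul, norm_space, norm_space]; exact P.sqrt_inner_left_le a x)

/-- The Hausdorff completion of `T` for the seminorm `‖⟨x, x⟩‖ ^ (1/2)`. -/
abbrev Compl : Type v := UniformSpace.Completion P.Space

/-- The canonical map into the completion. -/
noncomputable def toCompl : P.Space →L[ℂ] P.Compl := UniformSpace.Completion.toComplL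

/-- The inner product extended by continuity to the completion. -/
noncomputable def complInner : P.Compl →L⋆[ℂ] P.Compl →L[ℂ] A :=
  ((P.innerL.extend P.toCompl).flip.extend P.toCompl).flip

/-- An action of `A` extended by continuity to the completion. -/
noncomputable def complAct (B : A →L[ℂ] P.Space →L[ℂ] P.Space) :
    A →L[ℂ] P.Compl →L[ℂ] P.Compl :=
  ((((ContinuousLinearMap.compL ℂ P.Space P.Space P.Compl P.toCompl).comp B).flip).extend
    P.toCompl).flip

theorem denseRange_toCompl : DenseRange P.toCompl := UniformSpace.Completion.denseRange_coe
theorem isUniformInducing_toCompl : IsUniformInducing P.toCompl :=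
  UniformSpace.Completion.isUniformInducing_coe _

theorem complInner_coe (x y : P.Space) :
    P.complInner (P.toCompl x) (P.toCompl y) = P.onSpace.inner x y := by
  unfold complInner
  rw [ContinuousLinearMap.flip_apply,
    ContinuousLinearMap.extend_eq _ P.denseRange_toCompl P.isUniformInducing_toCompl,
    ContinuousLinearMap.flip_apply,
    ContinuousLinearMap.extend_eq _ P.denseRange_toCompl P.isUniformInducing_toCompl]
  rfl

theorem complAct_coe (B : A →L[ℂ] P.Space →L[ℂ] P.Space) (a : A) (x : P.Space) :
    P.complAct B a (P.toCompl x) = P.toCompl (B a x) := by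
  unfold complAct
  rw [ContinuousLinearMap.flip_apply,
    ContinuousLinearMap.extend_eq _ P.denseRange_toCompl P.isUniformInducing_toCompl]
  rfl

theorem compl_induction {p : P.Compl → Prop} (hp : IsClosed {x | p x})
    (h : ∀ x, p (P.toCompl x)) (x : P.Compl) : p x :=
  UniformSpace.Completion.induction_on x hp h

theorem compl_ext {F : Type*} [TopologicalSpace F] [T2Space F] {f g : P.Compl → F}
    (hf : Continuous f) (hg : Continuous g) (h : ∀ x, f (P.toCompl x) = g (P.toCompl x))
    (x : P.Compl) : f x = g x :=
  P.compl_induction (isClosed_eq hf hg) h x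

theorem compl_ext₂ {F : Type*} [TopologicalSpace F] [T2Space F] {f g : P.Compl → P.Compl → F}
    (hf : ∀ x, Continuous (f x)) (hg : ∀ x, Continuous (g x))
    (hf' : ∀ y, Continuous fun x => f x y) (hg' : ∀ y, Continuous fun x => g x y)
    (h : ∀ x y, f (P.toCompl x) (P.toCompl y) = g (P.toCompl x) (P.toCompl y))
    (x y : P.Compl) : f x y = g x y := by
  refine P.compl_ext (hf' y) (hg' y) (fun x => ?_) x
  exact P.compl_ext (hf _) (hg _) (fun y => h x y) y

/-- The structure of `P` extended by continuity to the completion. -/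
noncomputable def complPre : PreHilbertBimodule A P.Compl where
  inner := P.complInner.toLinearMap₁₂
  right := (P.complAct P.rightL).toLinearMap₁₂
  left := (P.complAct P.leftL).toLinearMap₁₂
  star_inner := by
    simp only [ContinuousLinearMap.toLinearMap₁₂_apply_apply_apply]
    refine P.compl_ext₂ (fun x => by fun_prop) (fun x => by fun_prop) (fun x => by fun_prop)
      (fun x => by fun_prop) fun x y => ?_
    rw [complInner_coe, complInner_coe, star_inner]
  inner_self := by
    let _ := CStarAlgebra.spectralOrder A
    have _ := CStarAlgebra.spectralOrderedRing A
    simp only [ContinuousLinearMap.toLinearMap₁₂_apply_apply_apply,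
      ← CStarAlgebra.nonneg_iff_eq_star_mul_self]
    refine P.compl_induction ?_ fun x => ?_
    · exact CStarAlgebra.isClosed_nonneg.preimage
        (f := fun x => P.complInner x x) (by fun_prop)
    · rw [complInner_coe]; exact P.onSpace.inner_nonneg x
  inner_right := by
    simp only [ContinuousLinearMap.toLinearMap₁₂_apply_apply_apply]
    intro x y a
    revert x y
    refine P.compl_ext₂ (fun x => by fun_prop) (fun x => by fun_prop) (fun x => by fun_prop)
      (fun x => by fun_prop) fun x y => ?_
    rw [complInner_coe, complAct_coe, complInner_coe]
    exact P.inner_right x y a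
  right_mul := by
    simp only [ContinuousLinearMap.toLinearMap₁₂_apply_apply_apply]
    intro a b
    refine P.compl_ext (by fun_prop) (by fun_prop) fun x => ?_
    rw [complAct_coe, complAct_coe, complAct_coe]
    exact congrArg P.toCompl (P.right_mul a b x)
  left_mul := by
    simp only [ContinuousLinearMap.toLinearMap₁₂_apply_apply_apply]
    intro a b
    refine P.compl_ext (by fun_prop) (by fun_prop) fun x => ?_
    rw [complAct_coe, complAct_coe, complAct_coe]
    exact congrArg P.toCompl (P.left_mul a b x)
  inner_left := by
    simp only [ContinuousLinearMap.toLinearMap₁₂_apply_apply_apply]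
    intro a
    refine P.compl_ext₂ (fun x => by fun_prop) (fun x => by fun_prop) (fun x => by fun_prop)
      (fun x => by fun_prop) fun x y => ?_
    rw [complAct_coe, complAct_coe, complInner_coe, complInner_coe]
    exact P.inner_left a x y
  left_right := by
    simp only [ContinuousLinearMap.toLinearMap₁₂_apply_apply_apply]
    intro a b
    refine P.compl_ext (by fun_prop) (by fun_prop) fun x => ?_
    rw [complAct_coe, complAct_coe, complAct_coe, complAct_coe]
    exact congrArg P.toCompl (P.left_right a b x)

theorem complPre_norm_sq (x : P.Compl) : ‖x‖ ^ 2 = ‖P.complPre.inner x x‖ := by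
  refine P.compl_ext (f := fun x => ‖x‖ ^ 2) (g := fun x => ‖P.complInner x x‖)
    (by fun_prop) (by fun_prop) (fun x => ?_) x
  rw [complInner_coe]
  have : ‖P.toCompl x‖ = ‖x‖ := UniformSpace.Completion.norm_coe x
  rw [this, norm_space, Real.sq_sqrt (norm_nonneg _)]

end Basic
end PreHilbertBimodule


/-- A Hilbert `A`-bimodule: a right Hilbert `A`-module, complete in the norm
`‖x‖ = ‖⟨x, x⟩‖ ^ (1/2)`, with a left action of `A` by adjointable operators. -/
structure HilbertBimodule (A : Type u) [NonUnitalCStarAlgebra A] where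
  carrier : Type v
  [normedAddCommGroup : NormedAddCommGroup carrier]
  [normedSpace : NormedSpace ℂ carrier]
  [completeSpace : CompleteSpace carrier]
  str : PreHilbertBimodule A carrier
  norm_sq : ∀ x, ‖x‖ ^ 2 = ‖str.inner x x‖

namespace HilbertBimodule
variable {A : Type u} [NonUnitalCStarAlgebra A]

instance : CoeSort (HilbertBimodule.{u, v} A) (Type v) := ⟨carrier⟩

attribute [instance] normedAddCommGroup normedSpace completeSpace

/-- The Hilbert bimodule obtained by completing a pre-Hilbert bimodule. -/
noncomputable def ofPre {T : Type v} [AddCommGroup T] [Module ℂ T] (P : PreHilbertBimodule A T) :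
    HilbertBimodule.{u, v} A where
  carrier := P.Compl
  str := P.complPre
  norm_sq := P.complPre_norm_sq

/-- The canonical linear map from a pre-Hilbert bimodule to its completion. -/
noncomputable def ofPreMk {T : Type v} [AddCommGroup T] [Module ℂ T]
    (P : PreHilbertBimodule A T) : T →ₗ[ℂ] ofPre P where
  toFun x := P.toCompl x
  map_add' := P.toCompl.map_add
  map_smul' := P.toCompl.map_smul

variable (A) in
/-- The `C⋆`-algebra `A` as a Hilbert bimodule over itself: `⟨a, b⟩ = a⋆ b`, with left and
right multiplication as actions. -/
noncomputable def self : HilbertBimodule.{u, u} A where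
  carrier := A
  str :=
    { inner := LinearMap.mk₂'ₛₗ _ _ (fun a b => star a * b)
        (by simp [add_mul]) (fun c a b => by simp [smul_mul_assoc]) (by simp [mul_add])
        (fun c a b => by simp [mul_smul_comm])
      right := (LinearMap.mul ℂ A).flip
      left := LinearMap.mul ℂ A
      star_inner := by simp
      inner_self := fun a => ⟨a, rfl⟩
      inner_right := by simp [mul_assoc]
      right_mul := by simp [mul_assoc]
      left_mul := by simp [mul_assoc]
      inner_left := by simp [mul_assoc]
      left_right := by simp [mul_assoc] }
  norm_sq a := by simp [CStarRing.norm_star_mul_self, sq]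

/-- Isomorphisms of Hilbert bimodules: linear bijections preserving the inner products and both
actions. -/
structure Iso (X : HilbertBimodule.{u, v} A) (Y : HilbertBimodule.{u, w} A) extends X ≃ₗ[ℂ] Y where
  map_inner : ∀ x x', Y.str.inner (toFun x) (toFun x') = X.str.inner x x'
  map_right : ∀ x a, toFun (X.str.right a x) = Y.str.right a (toFun x)
  map_left : ∀ a x, toFun (X.str.left a x) = Y.str.left a (toFun x)

section Tensor

/-- The negative part `N` of a self-adjoint element `M`. -/
theorem exists_neg_part {B : Type u} [NonUnitalCStarAlgebra B] (M : B) (hM : IsSelfAdjoint M) :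
    ∃ N S : B, N = star S * S ∧ N * M * N = -(star (S * N) * (S * N)) ∧
      (N = 0 → ∃ R, M = star R * R) := by
  let _ := CStarAlgebra.spectralOrder B
  have _ := CStarAlgebra.spectralOrderedRing B
  have hN0 : 0 ≤ M⁻ := CFC.negPart_nonneg M
  have hNs : star M⁻ = M⁻ := (IsSelfAdjoint.of_nonneg hN0).star_eq
  have hdec : M⁺ - M⁻ = M := CFC.posPart_sub_negPart M
  obtain ⟨S, hS⟩ := CStarAlgebra.nonneg_iff_eq_star_mul_self.mp hN0
  refine ⟨M⁻, S, hS, ?_, fun h => ?_⟩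
  · have h1 : M⁻ * M * M⁻ = -(M⁻ * M⁻ * M⁻) := by
      have h2 : M⁻ * (M⁺ - M⁻) * M⁻ = -(M⁻ * M⁻ * M⁻) := by
        rw [mul_sub, sub_mul, CFC.negPart_mul_posPart]; simp
      rwa [hdec] at h2
    rw [h1, star_mul, hNs]
    nth_rewrite 2 [hS]
    simp only [mul_assoc]
  · rw [h, sub_zero] at hdec
    exact CStarAlgebra.nonneg_iff_eq_star_mul_self.mp (hdec ▸ CFC.posPart_nonneg M)

/-- A matrix `G` over `A` with `∑ c_i⋆ G_ij c_j ≥ 0` for all `c` has the form `R⋆ R`. -/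
theorem exists_factor {n : Type} [Fintype n] (G : n → n → A)
    (hstar : ∀ i j, star (G i j) = G j i)
    (hpos : ∀ c : n → A, ∃ b, ∑ i, ∑ j, star (c i) * G i j * c j = star b * b) :
    ∃ R : n → n → A, ∀ i j, G i j = ∑ k, star (R k i) * R k j := by
  classical
  let _ := CStarAlgebra.spectralOrder A
  have _ := CStarAlgebra.spectralOrderedRing A
  let M : CStarMatrix n n A := CStarMatrix.ofMatrix (Matrix.of G)
  have hM : IsSelfAdjoint M := by
    ext i j; simp [M, CStarMatrix.star_apply, hstar]
  obtain ⟨N, S, hS, hneg, hfin⟩ := exists_neg_part M hM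
  have hNs : star N = N := by rw [hS]; simp
  have hR : ∃ R, M = star R * R := by
    have hdiag : ∀ j, (star (S * N) * (S * N)) j j = 0 := by
      intro j
      have h1 : 0 ≤ (star (S * N) * (S * N)) j j := by
        rw [CStarMatrix.mul_apply]
        exact Finset.sum_nonneg fun i _ => by
          rw [CStarMatrix.star_apply]; exact star_mul_self_nonneg _
      have h2 : 0 ≤ (N * M * N) j j := by
        obtain ⟨b, hb⟩ := hpos (fun i => N i j)
        have : (N * M * N) j j = star b * b := by
          rw [← hb, CStarMatrix.mul_apply, Finset.sum_comm]
          refine Finset.sum_congr rfl fun i _ => ?_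
          rw [CStarMatrix.mul_apply, Finset.sum_mul]
          refine Finset.sum_congr rfl fun l _ => ?_
          have : star (N l j) = N j l := by
            conv_rhs => rw [← hNs, CStarMatrix.star_apply]
          rw [this]
          rfl
        rw [this]; exact star_mul_self_nonneg b
      rw [hneg, CStarMatrix.neg_apply] at h2
      exact le_antisymm (neg_nonneg.mp h2) h1
    have hSN : S * N = 0 := by
      ext i j
      have h := hdiag j
      rw [CStarMatrix.mul_apply, Finset.sum_eq_zero_iff_of_nonneg] at h
      · have := h i (Finset.mem_univ _)
        rw [CStarMatrix.star_apply] at this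
        simpa [CStarRing.star_mul_self_eq_zero_iff] using this
      · intro i _
        rw [CStarMatrix.star_apply]; exact star_mul_self_nonneg _
    have hNN : N * N = 0 := by
      nth_rewrite 1 [hS]; rw [mul_assoc, hSN, mul_zero]
    exact hfin (by rw [← CStarRing.star_mul_self_eq_zero_iff, hNs, hNN])
  obtain ⟨R, hR⟩ := hR
  refine ⟨fun i j => R i j, fun i j => ?_⟩
  have : M i j = (star R * R) i j := by rw [← hR]
  rw [CStarMatrix.mul_apply] at this
  exact this

open TensorProduct

variable (X : HilbertBimodule.{u, v} A) (Y : HilbertBimodule.{u, w} A)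

/-- The sesquilinear form on the algebraic tensor product determined by
`⟨x ⊗ y, x' ⊗ y'⟩ = ⟨y, ⟨x, x'⟩ · y'⟩`. -/
noncomputable def tensorInner : (X ⊗[ℂ] Y) →ₗ⋆[ℂ] (X ⊗[ℂ] Y) →ₗ[ℂ] A :=
  TensorProduct.lift (LinearMap.mk₂'ₛₗ (starRingEnd ℂ) (starRingEnd ℂ)
    (fun x y => TensorProduct.lift (LinearMap.mk₂ ℂ
      (fun x' y' => Y.str.inner y (Y.str.left (X.str.inner x x') y'))
      (by simp) (by simp) (by simp) (by simp)))
    (by intros; ext; simp) (by intros; ext; simp) (by intros; ext; simp) (by intros; ext; simp))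

@[simp]
theorem tensorInner_tmul (x x' : X) (y y' : Y) :
    tensorInner X Y (x ⊗ₜ y) (x' ⊗ₜ y') = Y.str.inner y (Y.str.left (X.str.inner x x') y') := rfl

theorem tensorInner_ext {t t' : X ⊗[ℂ] Y → X ⊗[ℂ] Y → A}
    (h1 : ∀ a b c, t (a + b) c = t a c + t b c) (h2 : ∀ a b c, t a (b + c) = t a b + t a c)
    (h1' : ∀ a b c, t' (a + b) c = t' a c + t' b c) (h2' : ∀ a b c, t' a (b + c) = t' a b + t' a c)
    (h : ∀ x y x' y', t (x ⊗ₜ y) (x' ⊗ₜ y') = t' (x ⊗ₜ y) (x' ⊗ₜ y')) (a b) : t a b = t' a b := by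
  have z1 : ∀ c, t 0 c = 0 := fun c => by simpa using h1 0 0 c
  have z1' : ∀ c, t' 0 c = 0 := fun c => by simpa using h1' 0 0 c
  have z2 : ∀ c, t c 0 = 0 := fun c => by simpa using h2 c 0 0
  have z2' : ∀ c, t' c 0 = 0 := fun c => by simpa using h2' c 0 0
  induction a with
  | zero => rw [z1, z1']
  | add a a' ha ha' => rw [h1, h1', ha, ha']
  | tmul x y =>
    induction b with
    | zero => rw [z2, z2']
    | add b b' hb hb' => rw [h2, h2', hb, hb']
    | tmul x' y' => exact h x y x' y'

/-- Positivity of the form on the algebraic tensor product. -/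
theorem tensorInner_self (t : X ⊗[ℂ] Y) : ∃ b, tensorInner X Y t t = star b * b := by
  let _ := CStarAlgebra.spectralOrder A
  have _ := CStarAlgebra.spectralOrderedRing A
  obtain ⟨n, x, y, rfl⟩ := TensorProduct.exists_sum_tmul_eq t
  obtain ⟨R, hR⟩ := exists_factor (fun i j => X.str.inner (x i) (x j))
    (fun i j => X.str.star_inner _ _) (fun c => by
      obtain ⟨b, hb⟩ := X.str.inner_self (∑ i, X.str.right (c i) (x i))
      refine ⟨b, ?_⟩
      rw [← hb]
      simp only [map_sum, LinearMap.sum_apply, X.str.inner_right, X.str.inner_right_left]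
      rw [Finset.sum_comm])
  rw [← CStarAlgebra.nonneg_iff_eq_star_mul_self]
  have : tensorInner X Y (∑ i, x i ⊗ₜ y i) (∑ i, x i ⊗ₜ y i)
      = ∑ k, Y.str.inner (∑ i, Y.str.left (R k i) (y i)) (∑ i, Y.str.left (R k i) (y i)) := by
    have e1 : tensorInner X Y (∑ i, x i ⊗ₜ y i) (∑ i, x i ⊗ₜ y i)
        = ∑ j, ∑ i, ∑ k, Y.str.inner (y i) (Y.str.left (star (R k i) * R k j) (y j)) := by
      simp only [map_sum, LinearMap.sum_apply, tensorInner_tmul, hR]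
    have e2 : ∀ k, Y.str.inner (∑ i, Y.str.left (R k i) (y i)) (∑ i, Y.str.left (R k i) (y i))
        = ∑ j, ∑ i, Y.str.inner (y i) (Y.str.left (star (R k i) * R k j) (y j)) := by
      intro k
      simp only [map_sum, LinearMap.sum_apply, Y.str.inner_left, Y.str.left_mul]
    simp only [e1, e2]
    rw [Finset.sum_comm]
    refine (Finset.sum_congr rfl fun i _ => Finset.sum_comm).trans ?_
    rw [Finset.sum_comm]
    refine Finset.sum_congr rfl fun k _ => Finset.sum_comm
  rw [this]
  exact Finset.sum_nonneg fun k _ => Y.str.inner_nonneg _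

/-- The algebraic tensor product as a pre-Hilbert bimodule, with `a · (x ⊗ y) = (a · x) ⊗ y` and
`(x ⊗ y) · a = x ⊗ (y · a)`. -/
noncomputable def tensorPre : PreHilbertBimodule A (X ⊗[ℂ] Y) where
  inner := tensorInner X Y
  right := (LinearMap.lTensorHom X).comp Y.str.right
  left := (LinearMap.rTensorHom Y).comp X.str.left
  star_inner := tensorInner_ext X Y (by simp) (by simp) (by simp) (by simp) fun x y x' y' => by
    rw [tensorInner_tmul, tensorInner_tmul, Y.str.star_inner, Y.str.inner_left, X.str.star_inner]
  inner_self := tensorInner_self X Y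
  inner_right t t' a := by
    revert t t'
    refine tensorInner_ext X Y (by simp) (by simp) (by simp [add_mul]) (by simp [add_mul])
      fun x y x' y' => ?_
    simp [Y.str.left_right, Y.str.inner_right]
  right_mul a b t := by
    induction t with
    | zero => simp
    | add s t hs ht => simp_all
    | tmul x y => simp [Y.str.right_mul]
  left_mul a b t := by
    induction t with
    | zero => simp
    | add s t hs ht => simp_all
    | tmul x y => simp [X.str.left_mul]
  inner_left a := by
    refine tensorInner_ext X Y (by simp) (by simp) (by simp) (by simp)
      fun x y x' y' => ?_
    simp [X.str.inner_left]
  left_right a b t := by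
    induction t with
    | zero => simp
    | add s t hs ht => simp_all
    | tmul x y => simp

/-- The internal (balanced) tensor product `X ⊗_A Y`: the completion of the algebraic tensor
product for `⟨x ⊗ y, x' ⊗ y'⟩ = ⟨y, ⟨x, x'⟩ · y'⟩`. The vectors `(x · a) ⊗ y - x ⊗ (a · y)` have
length zero, hence vanish in it. -/
noncomputable def tensor : HilbertBimodule.{u, max v w} A := ofPre (tensorPre X Y)

/-- The elementary tensor `x ⊗ y` in `X ⊗_A Y`. -/
noncomputable def tmul (x : X) (y : Y) : tensor X Y := ofPreMk (tensorPre X Y) (x ⊗ₜ y)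

end Tensor
end HilbertBimodule

/-- A product system over the (additively written) monoid `P` with fibres `X p`: an associative
multiplication `X p × X q → X (p + q)` on the disjoint union `⨆ X p` such that `x ⊗ y ↦ x y`
determines an isomorphism `X p ⊗_A X q ≅ X (p + q)` of Hilbert bimodules for all `p` and `q`,
together with an identification of `X 0` with `A` for which multiplication by elements of `X 0`
from the left and from the right is the left and the right action of `A`. -/
structure ProductSystem {A : Type u} [NonUnitalCStarAlgebra A] {P : Type w} [AddMonoid P]
    (X : P → HilbertBimodule.{u, v} A) where
  mul : ∀ {p q : P}, X p → X q → X (p + q)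
  mul_assoc : ∀ {p q r : P} (x : X p) (y : X q) (z : X r),
    (⟨p + q + r, mul (mul x y) z⟩ : Σ s, X s) = ⟨p + (q + r), mul x (mul y z)⟩
  tensor_iso : ∀ p q : P, ∃ Φ : HilbertBimodule.Iso ((X p).tensor (X q)) (X (p + q)),
    ∀ (x : X p) (y : X q), Φ.toFun (HilbertBimodule.tmul (X p) (X q) x y) = mul x y
  unit : HilbertBimodule.Iso (HilbertBimodule.self A) (X 0)
  unit_mul : ∀ {p : P} (a : A) (x : X p),
    (⟨0 + p, mul (unit.toFun a) x⟩ : Σ s, X s) = ⟨p, (X p).str.left a x⟩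
  mul_unit : ∀ {p : P} (x : X p) (a : A),
    (⟨p + 0, mul x (unit.toFun a)⟩ : Σ s, X s) = ⟨p, (X p).str.right a x⟩

section Fibre
set_option linter.unusedSectionVars false
variable {Y : Type u} {Z : Type v} [TopologicalSpace Y] [TopologicalSpace Z] [T2Space Y] [T2Space Z]
  {s : Y → Z}

/-- The function `z ↦ ∑_{s y = z} f y`. -/
noncomputable def fibreSum (s : Y → Z) (f : Y → ℂ) (z : Z) : ℂ := ∑ᶠ y ∈ s ⁻¹' {z}, f y

theorem fibre_finite (hs : IsLocalHomeomorph s) (f : C_c(Y, ℂ)) (z : Z) :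
    (s ⁻¹' {z} ∩ tsupport f).Finite := by
  have hc : IsCompact (s ⁻¹' {z} ∩ tsupport f) :=
    f.hasCompactSupport.inter_left (isClosed_singleton.preimage hs.continuous)
  refine hc.finite ?_
  rw [isDiscrete_iff_forall_mem_exists_isOpen]
  intro y hy
  obtain ⟨e, hye, rfl⟩ := hs y
  refine ⟨e.source, e.open_source, ?_⟩
  ext y'
  constructor
  · rintro ⟨h1, h2, -⟩
    exact e.injOn h1 hye ((show e y' = z from h2).trans (show e y = z from hy.1).symm)
  · rintro rfl
    exact ⟨hye, hy⟩

theorem fibre_finite' (hs : IsLocalHomeomorph s) (f : C_c(Y, ℂ)) (z : Z) :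
    (s ⁻¹' {z} ∩ Function.support f).Finite :=
  (fibre_finite hs f z).subset (Set.inter_subset_inter_right _ subset_closure)

theorem continuous_fibreSum (hs : IsLocalHomeomorph s) (f : C_c(Y, ℂ)) :
    Continuous (fibreSum s f) := by
  classical
  rw [continuous_iff_continuousAt]
  intro z
  have hfin := fibre_finite hs f z
  obtain ⟨U, hU, hdis⟩ := hfin.t2_separation
  choose e hye hes using hs
  set I := hfin.toFinset with hI
  have hIm : ∀ {y}, y ∈ I ↔ s y = z ∧ y ∈ tsupport f := by simp [hI]
  set C : Set Y := tsupport f \ ⋃ y ∈ I, ((e y).source ∩ U y) with hC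
  have hopen : ∀ y, IsOpen ((e y).source ∩ U y) := fun y => (e y).open_source.inter (hU y).2
  have hCc : IsCompact C := f.hasCompactSupport.diff (isOpen_biUnion fun y _ => hopen y)
  have hcont : Continuous s := (IsLocalHomeomorph.mk s fun y => ⟨e y, hye y, fun _ _ => by rw [← hes y]⟩).continuous
  have hzC : z ∉ s '' C := by
    rintro ⟨y, ⟨hy1, hy2⟩, hyz⟩
    exact hy2 (Set.mem_biUnion (hIm.mpr ⟨hyz, hy1⟩) ⟨hye y, (hU y).1⟩)
  have hev : ∀ᶠ z' in 𝓝 z, fibreSum s f z' = ∑ y ∈ I, f ((e y).symm z') := by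
    have h1 : ∀ᶠ z' in 𝓝 z, z' ∉ s '' C := (hCc.image hcont).isClosed.isOpen_compl.mem_nhds hzC
    have h2 : ∀ᶠ z' in 𝓝 z, ∀ y ∈ I, z' ∈ (e y).target ∧ (e y).symm z' ∈ U y := by
      rw [Filter.eventually_all_finset]
      intro y hy
      have hyz : e y y = z := by rw [← hes y]; exact (hIm.mp hy).1
      have hzt : z ∈ (e y).target := hyz ▸ (e y).map_source (hye y)
      refine Filter.Eventually.and ((e y).open_target.mem_nhds hzt) ?_
      refine ((e y).continuousAt_symm hzt).eventually ((hU y).2.mem_nhds ?_)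
      rw [← hyz, (e y).left_inv (hye y)]; exact (hU y).1
    filter_upwards [h1, h2] with z' h1 h2
    have hinj : Set.InjOn (fun y => (e y).symm z') (I : Set Y) := by
      intro y hy y' hy' h
      by_contra hne
      have := hdis (hIm.mp hy) (hIm.mp hy') hne
      exact Set.disjoint_left.mp this (h2 y hy).2 ((show (e y).symm z' = _ from h) ▸ (h2 y' hy').2)
    rw [← Finset.sum_image (g := fun y => (e y).symm z') hinj, fibreSum]
    refine finsum_mem_eq_sum_of_inter_support_eq _ ?_
    ext y
    simp only [Set.mem_inter_iff, Set.mem_preimage, Set.mem_singleton_iff, Finset.coe_image,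
      Set.mem_image, Finset.mem_coe, and_congr_left_iff]
    intro hy
    constructor
    · intro hyz'
      have hyC : y ∉ C := fun h => h1 ⟨y, h, hyz'⟩
      have : y ∈ ⋃ y ∈ I, ((e y).source ∩ U y) := by
        by_contra h
        exact hyC ⟨subset_closure hy, h⟩
      obtain ⟨y0, hy0, hy1, hy2⟩ := Set.mem_iUnion₂.mp this
      refine ⟨y0, hy0, ?_⟩
      rw [← hyz', hes y0, (e y0).left_inv hy1]
    · rintro ⟨y0, hy0, rfl⟩
      have := (e y0).right_inv (h2 y0 hy0).1
      rwa [← hes y0] at this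
  refine ContinuousAt.congr ?_ (Filter.EventuallyEq.symm hev)
  refine tendsto_finsetSum _ fun y hy => ?_
  have hyz : e y y = z := by rw [← hes y]; exact (hIm.mp hy).1
  have hzt : z ∈ (e y).target := hyz ▸ (e y).map_source (hye y)
  exact (f.continuous.continuousAt.comp ((e y).continuousAt_symm hzt))

/-- For a local homeomorphism `s`, summation over the fibres of `s` maps `C_c(Y)` to `C₀(Z)`. -/
noncomputable def fibreSumC₀ (hs : IsLocalHomeomorph s) : C_c(Y, ℂ) →ₗ[ℂ] C₀(Z, ℂ) where
  toFun f :=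
    { toFun := fibreSum s f
      continuous_toFun := continuous_fibreSum hs f
      zero_at_infty' := by
        refine HasCompactSupport.is_zero_at_infty ?_
        refine HasCompactSupport.intro (f.hasCompactSupport.image hs.continuous) fun z hz => ?_
        refine finsum_mem_eq_zero_of_forall_eq_zero fun y hy => ?_
        by_contra h
        exact hz ⟨y, subset_closure h, hy⟩ }
  map_add' f g := by
    ext z
    exact finsum_mem_add_distrib' (fibre_finite' hs f z) (fibre_finite' hs g z)
  map_smul' c f := by
    ext z
    exact (AddMonoidHom.map_finsum_mem' (AddMonoidHom.mulLeft c) (fibre_finite' hs f z)).symm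

theorem fibreSumC₀_apply (hs : IsLocalHomeomorph s) (f : C_c(Y, ℂ)) (z : Z) :
    fibreSumC₀ hs f z = ∑ᶠ y ∈ s ⁻¹' {z}, f y := rfl

/-- Multiplication of `f ∈ C_c(Y)` by `a ∘ r` for `a ∈ C₀(Z)`. -/
noncomputable def mulAct (r : C(Y, Z)) : C₀(Z, ℂ) →ₗ[ℂ] C_c(Y, ℂ) →ₗ[ℂ] C_c(Y, ℂ) :=
  LinearMap.mk₂ ℂ (fun a f => 
     { toFun := fun y => a (r y) * f y
       hasCompactSupport' := f.hasCompactSupport.mul_left })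
   (fun _ _ _ => by ext; simp [add_mul]) (fun _ _ _ => by ext; simp [mul_assoc])
   (fun _ _ _ => by ext; simp [mul_add]) (fun _ _ _ => by ext; simp [mul_left_comm])

@[simp]
theorem mulAct_apply (r : C(Y, Z)) (a : C₀(Z, ℂ)) (f : C_c(Y, ℂ)) (y : Y) :
    mulAct r a f y = a (r y) * f y := rfl

/-- The pre-Hilbert `C₀(Z)`-bimodule `C_c(Y)` of a topological graph with vertex space `Z`, edge
space `Y`, source map `s` (a local homeomorphism) and range map `r`:
`⟨f, g⟩ z = ∑_{s y = z} conj (f y) * g y`, `(f · a) y = f y * a (s y)`, `(a · f) y = a (r y) * f y`. -/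
noncomputable def graphPre (hs : IsLocalHomeomorph s) (r : C(Y, Z)) :
    PreHilbertBimodule C₀(Z, ℂ) C_c(Y, ℂ) where
  inner := LinearMap.mk₂'ₛₗ (starRingEnd ℂ) (RingHom.id ℂ) (fun f g => fibreSumC₀ hs (star f * g))
    (fun f f' g => by rw [star_add, add_mul, map_add])
    (fun c f g => by rw [star_smul, smul_mul_assoc, map_smul]; rfl)
    (fun f g g' => by rw [mul_add, map_add])
    (fun c f g => by rw [mul_smul_comm, map_smul]; rfl)
  right := mulAct ⟨s, hs.continuous⟩
  left := mulAct r
  star_inner f g := by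
    ext z
    simp only [LinearMap.mk₂'ₛₗ_apply, ZeroAtInftyContinuousMap.star_apply, fibreSumC₀_apply]
    refine (AddMonoidHom.map_finsum_mem' (starAddEquiv (R := ℂ)).toAddMonoidHom
      (fibre_finite' hs (star f * g) z)).trans ?_
    refine finsum_mem_congr rfl fun y _ => ?_
    simp [mul_comm]
  inner_self f := by
    have hnn : ∀ z, 0 ≤ fibreSumC₀ hs (star f * f) z := fun z => by
      rw [fibreSumC₀_apply]
      exact finsum_mem_induction (0 ≤ ·) le_rfl (fun _ _ => add_nonneg)
        fun y _ => star_mul_self_nonneg (f y)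
    refine ⟨{ toFun := fun z => (√(fibreSumC₀ hs (star f * f) z).re : ℂ)
              continuous_toFun := by fun_prop
              zero_at_infty' := ?_ }, ?_⟩
    · have hc : Continuous fun w : ℂ => ((√w.re : ℝ) : ℂ) := by fun_prop
      have := (hc.tendsto 0).comp (fibreSumC₀ hs (star f * f)).zero_at_infty'
      simpa [Function.comp_def] using this
    · ext z
      obtain ⟨h1, h2⟩ := Complex.nonneg_iff.mp (hnn z)
      simp only [LinearMap.mk₂'ₛₗ_apply, ZeroAtInftyContinuousMap.mul_apply,
        ZeroAtInftyContinuousMap.star_apply, ZeroAtInftyContinuousMap.coe_mk,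
        Complex.star_def, Complex.conj_ofReal, ← Complex.ofReal_mul,
        Real.mul_self_sqrt h1]
      exact Complex.ext rfl h2.symm
  inner_right f g a := by
    ext z
    simp only [LinearMap.mk₂'ₛₗ_apply, ZeroAtInftyContinuousMap.mul_apply, fibreSumC₀_apply]
    refine Eq.trans ?_ (AddMonoidHom.map_finsum_mem' (AddMonoidHom.mulRight (a z))
      (fibre_finite' hs (star f * g) z)).symm
    refine finsum_mem_congr rfl fun y hy => ?_
    have : s y = z := hy
    simp [this]; ring
  right_mul a b f := by ext; simp; ring
  left_mul a b f := by ext; simp; ring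
  inner_left a f g := by
    simp only [LinearMap.mk₂'ₛₗ_apply]
    congr 1
    ext y; simp; ring
  left_right a b f := by ext; simp; ring
/-- The Hilbert `C₀(Z)`-bimodule of a topological graph, the completion of `C_c(Y)`. -/
noncomputable def graphBimodule (hs : IsLocalHomeomorph s) (r : C(Y, Z)) :
    HilbertBimodule C₀(Z, ℂ) :=
  HilbertBimodule.ofPre (graphPre hs r)

end Fibre

/-- A `k`-graph: a countable small category with a degree functor to `ℕ^k` that has the unique
factorisation property. A morphism `f : a ⟶ b` is a path with range `a` and source `b`, so the
composite `λμ` of paths (defined when `s(λ) = r(μ)`) is written `λ ≫ μ`. -/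
structure KGraph (k : ℕ) where
  Obj : Type u
  [category : Category.{v} Obj]
  countable : Countable (Σ a b : Obj, (a ⟶ b))
  degree : ∀ {a b : Obj}, (a ⟶ b) → (Fin k → ℕ)
  degree_id : ∀ a : Obj, degree (𝟙 a) = 0
  degree_comp : ∀ {a b c : Obj} (f : a ⟶ b) (g : b ⟶ c), degree (f ≫ g) = degree f + degree g
  factorisation : ∀ {a b : Obj} (f : a ⟶ b) (m n : Fin k → ℕ), degree f = m + n →
    ∃! q : (Σ c : Obj, (a ⟶ c) × (c ⟶ b)),
      degree q.2.1 = m ∧ degree q.2.2 = n ∧ q.2.1 ≫ q.2.2 = f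

namespace KGraph
attribute [instance] category
variable {k : ℕ} (Λ : KGraph.{u, v} k)

/-- The type of all paths, i.e. of all morphisms of `Λ`. -/
abbrev Path : Type (max u v) := Σ a b : Λ.Obj, (a ⟶ b)

/-- The set `vΛ` of paths with range `v`. -/
abbrev From (v : Λ.Obj) : Type (max u v) := Σ b : Λ.Obj, (v ⟶ b)

variable {Λ}

/-- A morphism, regarded as an element of the type of all paths. -/
def path {a b : Λ.Obj} (f : a ⟶ b) : Λ.Path := ⟨a, b, f⟩

/-- `Λ^min(f, g)`: the pairs `(α, β)` with `fα = gβ` and `d(fα) = d(f) ∨ d(g)`. (For paths with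
different ranges there are no such pairs.) -/
def minExt {a b c : Λ.Obj} (f : a ⟶ b) (g : a ⟶ c) : Set (Σ e : Λ.Obj, (b ⟶ e) × (c ⟶ e)) :=
  {q | f ≫ q.2.1 = g ≫ q.2.2 ∧ Λ.degree (f ≫ q.2.1) = Λ.degree f ⊔ Λ.degree g}

variable (Λ) in
/-- `Λ` is finitely aligned: every set `Λ^min(f, g)` is finite. -/
def FinitelyAligned : Prop :=
  ∀ {a b c : Λ.Obj} (f : a ⟶ b) (g : a ⟶ c), (minExt f g).Finite

/-- A set `E` of paths with range `a` is exhaustive: every path with range `a` has a common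
extension with some element of `E`. -/
def Exhaustive {a : Λ.Obj} (E : Set (Λ.From a)) : Prop :=
  ∀ g : Λ.From a, ∃ f ∈ E, (minExt f.2 g.2).Nonempty

theorem factor_unique {a b c a' b' c' : Λ.Obj} {f : a ⟶ b} {g : b ⟶ c} {f' : a' ⟶ b'}
    {g' : b' ⟶ c'} (h : path (f ≫ g) = path (f' ≫ g')) (hd : Λ.degree f = Λ.degree f') :
    path f = path f' ∧ path g = path g' := by
  obtain ⟨rfl, h⟩ := Sigma.mk.inj_iff.mp h
  obtain ⟨rfl, h⟩ := Sigma.mk.inj_iff.mp (eq_of_heq h)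
  have h := eq_of_heq h
  have hg : Λ.degree g = Λ.degree g' := by
    have := congrArg Λ.degree h
    rw [Λ.degree_comp, Λ.degree_comp, hd] at this
    exact add_left_cancel this
  obtain ⟨q, -, hq⟩ := Λ.factorisation (f ≫ g) (Λ.degree f) (Λ.degree g) (Λ.degree_comp f g)
  have h1 := hq ⟨b, f, g⟩ ⟨rfl, rfl, rfl⟩
  have h2 := hq ⟨b', f', g'⟩ ⟨hd.symm, hg.symm, h.symm⟩
  cases h1.trans h2.symm
  exact ⟨rfl, rfl⟩

theorem path_comp_congr {a b c a' b' c' : Λ.Obj} {f : a ⟶ b} {g : b ⟶ c} {f' : a' ⟶ b'}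
    {g' : b' ⟶ c'} (h : path f = path f') (h' : path g = path g') :
    path (f ≫ g) = path (f' ≫ g') := by
  cases h; cases h'; rfl

theorem path_inj {a b : Λ.Obj} {f g : a ⟶ b} (h : path f = path g) : f = g := by
  cases h; rfl

theorem degree_congr {a b a' b' : Λ.Obj} {f : a ⟶ b} {g : a' ⟶ b'} (h : path f = path g) :
    Λ.degree f = Λ.degree g := by
  cases h; rfl

theorem path_eq_id {a b : Λ.Obj} {f : a ⟶ b} (h : Λ.degree f = 0) : path f = path (𝟙 a) :=
  (factor_unique (f := f) (g := 𝟙 b) (f' := 𝟙 a) (g' := f) (by simp)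
    (by rw [h, Λ.degree_id])).1

theorem comp_left_cancel {a b c : Λ.Obj} {f : a ⟶ b} {g g' : b ⟶ c} (h : f ≫ g = f ≫ g') :
    g = g' :=
  path_inj (factor_unique (congrArg path h) rfl).2

theorem exists_factor {a b : Λ.Obj} (f : a ⟶ b) {m : Fin k → ℕ} (hm : m ≤ Λ.degree f) :
    ∃ (c : Λ.Obj) (g : a ⟶ c) (h : c ⟶ b), Λ.degree g = m ∧ g ≫ h = f := by
  obtain ⟨⟨c, g, h⟩, ⟨h1, -, h3⟩, -⟩ := Λ.factorisation f m (Λ.degree f - m)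
    (add_tsub_cancel_of_le hm).symm
  exact ⟨c, g, h, h1, h3⟩

/-- Two initial segments of the same path are comparable. -/
theorem exists_comp_of_comp_eq {a b c e : Λ.Obj} {f : a ⟶ b} {g : b ⟶ e} {f' : a ⟶ c} {g' : c ⟶ e}
    (h : f ≫ g = f' ≫ g') (hd : Λ.degree f ≤ Λ.degree f') : ∃ t : b ⟶ c, f ≫ t = f' := by
  obtain ⟨d, p, q, hp, hpq⟩ := exists_factor f' hd
  have := (factor_unique (f := f) (g := g) (f' := p) (g' := q ≫ g')
    (by rw [h, ← hpq, Category.assoc]) hp.symm).1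
  cases this
  exact ⟨q, hpq⟩

theorem minExt_nonempty {a b c e : Λ.Obj} {f : a ⟶ b} {g : a ⟶ c} {s : b ⟶ e} {t : c ⟶ e}
    (h : f ≫ s = g ≫ t) : ∃ q ∈ minExt f g, ∃ r : q.1 ⟶ e, q.2.1 ≫ r = s ∧ q.2.2 ≫ r = t := by
  have h1 : Λ.degree f ≤ Λ.degree (f ≫ s) := by rw [Λ.degree_comp]; exact le_self_add
  have h2 : Λ.degree g ≤ Λ.degree (f ≫ s) := by rw [h, Λ.degree_comp]; exact le_self_add
  obtain ⟨d, p, q, hp, hpq⟩ := exists_factor (f ≫ s) (sup_le h1 h2)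
  obtain ⟨α, hα⟩ := exists_comp_of_comp_eq hpq.symm (le_sup_left.trans_eq hp.symm)
  obtain ⟨β, hβ⟩ := exists_comp_of_comp_eq (h.symm.trans hpq.symm) (le_sup_right.trans_eq hp.symm)
  refine ⟨⟨d, α, β⟩, ⟨hα.trans hβ.symm, by rw [hα, hp]⟩, q, ?_, ?_⟩
  · refine comp_left_cancel (f := f) ?_
    rw [← Category.assoc, hα, hpq]
  · refine comp_left_cancel (f := g) ?_
    rw [← Category.assoc, hβ, hpq, h]

variable (k) in
/-- The objects `{p ∈ ℕ^k : p ≤ m}` of `Ω_{k,m}`. As a preorder this is the category `Ω_{k,m}`: a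
unique morphism `(p, q) : p ⟶ q` whenever `p ≤ q`, with `(p, q) ≫ (q, r) = (p, r)`. -/
abbrev Box (m : Fin k → ℕ∞) : Type := {p : Fin k → ℕ // ∀ i, (p i : ℕ∞) ≤ m i}

variable (Λ) in
/-- A graph morphism `x : Ω_{k,m} → Λ`, i.e. a degree-preserving functor, of degree `d(x) = m`. -/
structure GraphMorphism where
  deg : Fin k → ℕ∞
  functor : Box k deg ⥤ Λ.Obj
  degree_map : ∀ {p q : Box k deg} (h : p ⟶ q), Λ.degree (functor.map h) = q.1 - p.1

namespace GraphMorphism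

/-- `p ≤ d(x)`. -/
abbrev Le (p : Fin k → ℕ) (x : Λ.GraphMorphism) : Prop := ∀ i, (p i : ℕ∞) ≤ x.deg i

variable (x : Λ.GraphMorphism)

theorem Le.mono {p q : Fin k → ℕ} {x : Λ.GraphMorphism} (hq : Le q x) (hpq : p ≤ q) : Le p x :=
  fun i => (Nat.cast_le.mpr (hpq i)).trans (hq i)

theorem le_zero : Le 0 x := fun i => by simp

/-- The vertex `x(p)`. -/
def vertex (p : Fin k → ℕ) (hp : Le p x) : Λ.Obj := x.functor.obj ⟨p, hp⟩

/-- The path `x(p, q)`. -/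
def seg {p q : Fin k → ℕ} (hpq : p ≤ q) (hq : Le q x) :
    x.vertex p (hq.mono hpq) ⟶ x.vertex q hq :=
  x.functor.map (homOfLE (show (⟨p, hq.mono hpq⟩ : Box k x.deg) ≤ ⟨q, hq⟩ from hpq))

theorem degree_seg {p q : Fin k → ℕ} (hpq : p ≤ q) (hq : Le q x) :
    Λ.degree (x.seg hpq hq) = q - p := x.degree_map _

theorem seg_comp {p q r : Fin k → ℕ} (hpq : p ≤ q) (hqr : q ≤ r) (hr : Le r x) :
    x.seg hpq (hr.mono hqr) ≫ x.seg hqr hr = x.seg (hpq.trans hqr) hr :=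
  (x.functor.map_comp _ _).symm

theorem seg_self {p : Fin k → ℕ} (hp : Le p x) : x.seg le_rfl hp = 𝟙 (x.vertex p hp) :=
  x.functor.map_id _

theorem path_seg_congr {p q p' q' : Fin k → ℕ} (hpq : p ≤ q) (hq : Le q x)
    (h : p = p') (h' : q = q') :
    path (x.seg hpq hq) = path (x.seg (h ▸ h' ▸ hpq : p' ≤ q') (h' ▸ hq)) := by
  subst h; subst h'; rfl

/-- `x(0, d(f)) = f`. -/
def HasInit {a b : Λ.Obj} (f : a ⟶ b) : Prop :=
  ∃ h : Le (Λ.degree f) x, path (x.seg (zero_le (a := Λ.degree f)) h) = path f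

variable {x}

theorem hasInit_iff {a b : Λ.Obj} {f : a ⟶ b} :
    x.HasInit f ↔ ∃ (p : Fin k → ℕ) (h : Le p x), path (x.seg (zero_le (a := p)) h) = path f := by
  refine ⟨fun ⟨h, e⟩ => ⟨_, h, e⟩, fun ⟨p, h, e⟩ => ?_⟩
  have : p = Λ.degree f := by rw [← degree_congr e, degree_seg, tsub_zero]
  subst this
  exact ⟨h, e⟩

theorem hasInit_seg {p : Fin k → ℕ} (h : Le p x) : x.HasInit (x.seg (zero_le (a := p)) h) :=
  hasInit_iff.mpr ⟨p, h, rfl⟩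

theorem HasInit.congr {a b a' b' : Λ.Obj} {f : a ⟶ b} {g : a' ⟶ b'} (h : path f = path g)
    (hf : x.HasInit f) : x.HasInit g := by
  cases h; exact hf

theorem HasInit.unique {a b a' b' : Λ.Obj} {f : a ⟶ b} {g : a' ⟶ b'} (hf : x.HasInit f)
    (hg : x.HasInit g) (hd : Λ.degree f = Λ.degree g) : path f = path g := by
  obtain ⟨h, e⟩ := hf
  obtain ⟨h', e'⟩ := hg
  rw [← e, ← e']
  exact x.path_seg_congr _ _ rfl hd

theorem HasInit.seg_eq {a b : Λ.Obj} {f : a ⟶ b} (hf : x.HasInit f) {p : Fin k → ℕ} (hp : Le p x)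
    (h : Λ.degree f = p) : path (x.seg (zero_le (a := p)) hp) = path f :=
  (hasInit_seg hp).unique hf (by rw [degree_seg, h, tsub_zero])

theorem HasInit.exists_comp {a b : Λ.Obj} {f : a ⟶ b} (hf : x.HasInit f) {N : Fin k → ℕ}
    (hN : Le N x) (hle : Λ.degree f ≤ N) :
    ∃ s : b ⟶ x.vertex N hN, path (f ≫ s) = path (x.seg (zero_le (a := N)) hN) := by
  obtain ⟨p, hp, e⟩ := hasInit_iff.mp hf
  have hpN : p ≤ N := by rwa [← degree_congr e, degree_seg, tsub_zero] at hle
  cases e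
  exact ⟨x.seg hpN hN, congrArg path (x.seg_comp _ hpN hN)⟩

/-- The shift `x(· + n)` of a graph morphism `x` with `d(x) ≥ n`; it has degree `d(x) - n`. -/
def shift (x : Λ.GraphMorphism) (n : Fin k → ℕ) (hn : Le n x) : Λ.GraphMorphism where
  deg i := x.deg i - n i
  functor := (Monotone.functor (f := fun p : Box k (fun i => x.deg i - n i) =>
      (⟨p.1 + n, fun i => by
        have := add_le_add_left (p.2 i) (n i : ℕ∞)
        rw [tsub_add_cancel_of_le (hn i)] at this
        simpa using this⟩ : Box k x.deg))
    (fun p q h => add_le_add_left (show p.1 ≤ q.1 from h) n)) ⋙ x.functor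
  degree_map h := by
    refine (x.degree_map _).trans ?_
    exact add_tsub_add_eq_tsub_right _ _ _

theorem le_shift {n p : Fin k → ℕ} {hn : Le n x} : Le p (x.shift n hn) ↔ Le (p + n) x := by
  refine forall_congr' fun i => ?_
  have : (x.shift n hn).deg i = x.deg i - n i := rfl
  rw [this, Pi.add_apply, Nat.cast_add]
  exact (ENat.addLECancellable_natCast (n i)).le_tsub_iff_right (hn i)

theorem shift_seg {n p q : Fin k → ℕ} {hn : Le n x} (hpq : p ≤ q) (hq : Le q (x.shift n hn)) :
    path ((x.shift n hn).seg hpq hq) = path (x.seg (add_le_add_left hpq n) (le_shift.mp hq)) := rfl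

theorem HasInit.of_comp {a b c : Λ.Obj} {f : a ⟶ b} {g : b ⟶ c} (h : x.HasInit (f ≫ g)) :
    x.HasInit f := by
  obtain ⟨h, e⟩ := h
  have hle : Λ.degree f ≤ Λ.degree (f ≫ g) := by rw [Λ.degree_comp]; exact le_self_add
  rw [← x.seg_comp (zero_le (a := Λ.degree f)) hle h] at e
  exact ⟨_, (factor_unique e (by rw [degree_seg, tsub_zero])).1⟩

theorem hasInit_comp_iff {a b c : Λ.Obj} {f : a ⟶ b} {g : b ⟶ c} {n : Fin k → ℕ} (hn : Le n x)
    (hf : Λ.degree f = n) : x.HasInit (f ≫ g) ↔ x.HasInit f ∧ (x.shift n hn).HasInit g := by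
  subst hf
  constructor
  · intro h
    refine ⟨h.of_comp, ?_⟩
    obtain ⟨h, e⟩ := h
    have hle : Λ.degree f ≤ Λ.degree (f ≫ g) := by rw [Λ.degree_comp]; exact le_self_add
    rw [← x.seg_comp (zero_le (a := Λ.degree f)) hle h] at e
    have e2 := (factor_unique e (by rw [degree_seg, tsub_zero])).2
    refine ⟨le_shift.mpr (by rwa [add_comm, ← Λ.degree_comp]), ?_⟩
    rw [shift_seg, ← e2]
    exact x.path_seg_congr _ _ (zero_add _) (by rw [Λ.degree_comp, add_comm])
  · rintro ⟨⟨h1, e1⟩, ⟨h2, e2⟩⟩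
    rw [shift_seg] at e2
    refine hasInit_iff.mpr ⟨_, le_shift.mp h2, ?_⟩
    rw [← x.seg_comp (zero_le (a := Λ.degree f)) le_add_self (le_shift.mp h2)]
    refine path_comp_congr e1 (Eq.trans ?_ e2)
    exact x.path_seg_congr _ _ (zero_add _).symm rfl

theorem ext_init {x y : Λ.GraphMorphism} (hd : x.deg = y.deg)
    (h : ∀ (p : Fin k → ℕ) (hx : Le p x) (hy : Le p y),
      path (x.seg (zero_le (a := p)) hx) = path (y.seg (zero_le (a := p)) hy)) : x = y := by
  have key : ∀ (p q : Fin k → ℕ) (hpq : p ≤ q) (hx : Le q x) (hy : Le q y),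
      path (x.seg hpq hx) = path (y.seg hpq hy) := by
    intro p q hpq hx hy
    refine (factor_unique (f := x.seg (zero_le (a := p)) (hx.mono hpq))
      (f' := y.seg (zero_le (a := p)) (hy.mono hpq)) ?_ ?_).2
    · rw [seg_comp, seg_comp]; exact h q hx hy
    · rw [degree_seg, degree_seg]
  obtain ⟨m, F, hF⟩ := x
  obtain ⟨m', G, hG⟩ := y
  obtain rfl : m = m' := hd
  have hFG : F = G := by
    refine CategoryTheory.Functor.hext (fun p => ?_) (fun p q f => ?_)
    · exact congrArg Sigma.fst (key p.1 p.1 le_rfl p.2 p.2)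
    · have := key p.1 q.1 (leOfHom f) q.2 q.2
      have h1 := (Sigma.mk.inj_iff.mp this).2
      have e1 : F.obj p = G.obj p := congrArg Sigma.fst this
      have e2 : F.obj q = G.obj q := congrArg (fun s => s.2.1) this
      change HEq (F.map (homOfLE (leOfHom f))) (G.map (homOfLE (leOfHom f)))
      have h3 : path (F.map (homOfLE (leOfHom f))) = path (G.map (homOfLE (leOfHom f))) := this
      revert h3
      generalize F.map (homOfLE (leOfHom f)) = s
      generalize G.map (homOfLE (leOfHom f)) = t
      revert s t
      rw [e1, e2]
      intro s t h3
      exact heq_of_eq (path_inj h3)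
  subst hFG
  rfl

/-- A path is determined by an initial segment and the corresponding shift. -/
theorem ext_shift {x y : Λ.GraphMorphism} {n : Fin k → ℕ} (hx : Le n x) (hy : Le n y)
    (h : path (x.seg (zero_le (a := n)) hx) = path (y.seg (zero_le (a := n)) hy))
    (hs : x.shift n hx = y.shift n hy) : x = y := by
  have hd : x.deg = y.deg := by
    funext i
    have h1 : (x.shift n hx).deg i = (y.shift n hy).deg i := by rw [hs]
    change x.deg i - n i = y.deg i - n i at h1
    rw [← tsub_add_cancel_of_le (hx i), h1, tsub_add_cancel_of_le (hy i)]
  refine ext_init hd fun p hpx hpy => ?_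
  have key : ∀ (z : Λ.GraphMorphism) (hz : Le n z) (hp : Le p z),
      Le (p - n) (z.shift n hz) := fun z hz hp => by
    refine le_shift.mpr fun i => ?_
    rw [Pi.add_apply, Pi.sub_apply, tsub_add_eq_max]
    rcases le_total (p i) (n i) with h | h
    · rw [max_eq_right h]; exact hz i
    · rw [max_eq_left h]; exact hp i
  have hle : p ≤ (p - n) + n := le_tsub_add
  have hNx := le_shift.mp (key x hx hpx)
  have hNy := le_shift.mp (key y hy hpy)
  have e1 : path (x.seg (le_add_self : n ≤ (p - n) + n) hNx)
      = path (y.seg (le_add_self : n ≤ (p - n) + n) hNy) := by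
    have hgen : ∀ (z z' : Λ.GraphMorphism) (hz : Le (p - n) z) (hz' : Le (p - n) z'), z = z' →
        path (z.seg (zero_le (a := p - n)) hz) = path (z'.seg (zero_le (a := p - n)) hz') := by
      rintro z z' hz hz' rfl; rfl
    have h2 := hgen _ _ (key x hx hpx) (key y hy hpy) hs
    rw [shift_seg, shift_seg] at h2
    refine Eq.trans ?_ (h2.trans ?_)
    · exact x.path_seg_congr _ _ (zero_add _).symm rfl
    · exact y.path_seg_congr _ _ (zero_add _) rfl
  have e2 := path_comp_congr h e1
  rw [seg_comp, seg_comp, ← x.seg_comp (zero_le (a := p)) hle hNx,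
    ← y.seg_comp (zero_le (a := p)) hle hNy] at e2
  exact (factor_unique e2 (by rw [degree_seg, degree_seg])).1

/-- A graph morphism built from a coherent family of initial segments. -/
theorem exists_of_prefixes (m : Fin k → ℕ∞) {a : Λ.Obj} (V : Box k m → Λ.From a)
    (hd : ∀ p, Λ.degree (V p).2 = p.1)
    (hV : ∀ p q : Box k m, p ≤ q → ∃ t : (V p).1 ⟶ (V q).1, (V p).2 ≫ t = (V q).2) :
    ∃ x : Λ.GraphMorphism, x.deg = m ∧ ∀ p, x.HasInit (V p).2 := by
  choose t ht using hV
  let F : Box k m ⥤ Λ.Obj :=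
    { obj := fun p => (V p).1
      map := fun {p q} h => t p q (leOfHom h)
      map_id := fun p => comp_left_cancel (f := (V p).2) (by rw [ht, Category.comp_id])
      map_comp := fun {p q r} f g => comp_left_cancel (f := (V p).2) (by
        rw [ht, ← Category.assoc, ht, ht]) }
  refine ⟨⟨m, F, fun {p q} h => ?_⟩, rfl, fun p => ?_⟩
  · have := congrArg Λ.degree (ht p q (leOfHom h))
    rw [Λ.degree_comp, hd, hd] at this
    change Λ.degree (t p q (leOfHom h)) = _
    rw [← this, add_tsub_cancel_left]
  · refine hasInit_iff.mpr ⟨p.1, p.2, ?_⟩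
    let z : Box k m := ⟨0, fun i => by simp⟩
    have hz : path (V z).2 = path (𝟙 a) := path_eq_id (hd z)
    have h1 : path ((V z).2 ≫ t z p (zero_le (a := p.1))) = path (𝟙 a ≫ (V p).2) := by
      rw [ht]; simp
    exact (factor_unique h1 (by rw [hd, Λ.degree_id])).2

/-- Concatenation `λx`. -/
theorem exists_concat {a b : Λ.Obj} (f : a ⟶ b) (y : Λ.GraphMorphism) (hy : y.HasInit (𝟙 b)) :
    ∃ (x : Λ.GraphMorphism) (h : Le (Λ.degree f) x), x.HasInit f ∧ x.shift _ h = y := by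
  have hb : y.vertex 0 (le_zero y) = b := by
    have := hy.seg_eq (le_zero y) (Λ.degree_id b)
    exact congrArg Sigma.fst this
  subst hb
  let m : Fin k → ℕ∞ := fun i => Λ.degree f i + y.deg i
  have hle : ∀ p : Box k m, Le (p.1 - Λ.degree f) y := fun p i => by
    have h : (p.1 i : ℕ∞) ≤ Λ.degree f i + y.deg i := p.2 i
    rw [Pi.sub_apply, ENat.natCast_sub]
    exact tsub_le_iff_left.mpr h
  let W : ∀ p : Box k m, a ⟶ y.vertex _ (hle p) := fun p =>
    f ≫ y.seg (zero_le (a := p.1 - Λ.degree f)) (hle p)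
  have hWd : ∀ p : Box k m, Λ.degree (W p) = Λ.degree f + (p.1 - Λ.degree f) := fun p => by
    simp only [W]
    rw [Λ.degree_comp, degree_seg, tsub_zero]
  have hex : ∀ p : Box k m, ∃ V : Λ.From a, ∃ s : V.1 ⟶ y.vertex _ (hle p),
      Λ.degree V.2 = p.1 ∧ V.2 ≫ s = W p := fun p => by
    obtain ⟨c, g, h, h1, h2⟩ := exists_factor (W p) (m := p.1) (by
      rw [hWd]; exact le_add_tsub)
    exact ⟨⟨c, g⟩, h, h1, h2⟩
  choose V s hV hs using hex
  obtain ⟨x, hxd, hx⟩ := exists_of_prefixes m V hV (fun p q hpq => by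
    have hpq' : p.1 - Λ.degree f ≤ q.1 - Λ.degree f :=
      tsub_le_tsub_right (show p.1 ≤ q.1 from hpq) _
    have h : W q = (V p).2 ≫ (s p ≫ y.seg hpq' (hle q)) := by
      rw [← Category.assoc, hs]
      simp only [W]
      rw [Category.assoc, seg_comp]
    exact exists_comp_of_comp_eq (h.symm.trans (hs q).symm) (by rw [hV, hV]; exact hpq))
  have hlef : Le (Λ.degree f) x := fun i => by
    rw [hxd]; exact le_self_add
  have hinit : ∀ (q : Fin k → ℕ) (hq : Le q y), x.HasInit (f ≫ y.seg (zero_le (a := q)) hq) := by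
    intro q hq
    let p : Box k m := ⟨Λ.degree f + q, fun i => by
      have := add_le_add_right (hq i) (Λ.degree f i : ℕ∞)
      simpa [m] using this⟩
    have hpq : p.1 - Λ.degree f = q := add_tsub_cancel_left _ _
    have h0 : Λ.degree (s p) = 0 := by
      have h1 := congrArg Λ.degree (hs p)
      rw [Λ.degree_comp, hV, hWd] at h1
      have h2 : Λ.degree f + (p.1 - Λ.degree f) = p.1 := by rw [hpq]
      exact add_eq_left.mp (h1.trans h2)
    have h2 : path (V p).2 = path (W p) := by
      rw [← hs p]
      refine Eq.trans ?_ (path_comp_congr rfl (path_eq_id h0).symm)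
      rw [Category.comp_id]
    have h3 : path (W p) = path (f ≫ y.seg (zero_le (a := q)) hq) :=
      path_comp_congr rfl (y.path_seg_congr _ _ rfl hpq)
    exact (hx p).congr (h2.trans h3)
  refine ⟨x, hlef, (hinit 0 (le_zero y)).of_comp, ext_init ?_ fun p hpx hpy => ?_⟩
  · funext i
    change x.deg i - Λ.degree f i = _
    rw [hxd]
    exact (ENat.addLECancellable_natCast _).add_tsub_cancel_left
  · have := ((hasInit_comp_iff hlef rfl).mp (hinit p hpy)).2
    exact this.seg_eq hpx (by rw [degree_seg, tsub_zero])


/-- `x` is a boundary path: for all `n ≤ d(x)` and all finite exhaustive sets `E` of paths with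
range `x(n)` there is `f ∈ E` with `x(n, n + d(f)) = f`. -/
def IsBoundary (x : Λ.GraphMorphism) : Prop :=
  ∀ (n : Fin k → ℕ) (hn : Le n x) (E : Set (Λ.From (x.vertex n hn))), E.Finite → Exhaustive E →
    ∃ f ∈ E, ∃ h : Le (n + Λ.degree f.2) x, path (x.seg le_self_add h) = path f.2

theorem IsBoundary.shift {x : Λ.GraphMorphism} (hx : x.IsBoundary) (n : Fin k → ℕ) (hn : Le n x) :
    (x.shift n hn).IsBoundary := by
  intro p hp E hE hE'
  obtain ⟨f, hf, h, e⟩ := hx (p + n) (le_shift.mp hp) E hE hE'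
  have h' : p + n + Λ.degree f.2 = p + Λ.degree f.2 + n := by abel
  refine ⟨f, hf, le_shift.mpr (h' ▸ h), ?_⟩
  rw [shift_seg]
  exact (x.path_seg_congr (add_le_add_left (le_self_add : p ≤ p + Λ.degree f.2) n) (h' ▸ h)
    rfl h'.symm).trans e

theorem IsBoundary.exists_of_vertex {x : Λ.GraphMorphism} (hx : x.IsBoundary) {n : Fin k → ℕ}
    (hn : Le n x) {a : Λ.Obj} (ha : x.vertex n hn = a) {E : Set (Λ.From a)} (hE : E.Finite)
    (hE' : Exhaustive E) :
    ∃ f ∈ E, ∃ h : Le (n + Λ.degree f.2) x, path (x.seg le_self_add h) = path f.2 := by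
  subst ha
  exact hx n hn E hE hE'

theorem IsBoundary.concat (hΛ : Λ.FinitelyAligned) {x : Λ.GraphMorphism} {m : Fin k → ℕ}
    (hm : Le m x) (hx : (x.shift m hm).IsBoundary) : x.IsBoundary := by
  intro p hp E hE hE'
  have hq : Le (p ⊔ m) x := fun i => by
    rcases le_total (p i) (m i) with h | h
    · rw [Pi.sup_apply, sup_eq_right.mpr h]; exact hm i
    · rw [Pi.sup_apply, sup_eq_left.mpr h]; exact hp i
  have hqm : (p ⊔ m) - m + m = p ⊔ m := tsub_add_cancel_of_le le_sup_right
  have hq' : Le ((p ⊔ m) - m) (x.shift m hm) := le_shift.mpr (hqm.symm ▸ hq)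
  set α := x.seg (le_sup_left : p ≤ p ⊔ m) hq with hα
  let E' : Set (Λ.From (x.vertex _ hq)) :=
    ⋃ g ∈ E, (fun r => (⟨r.1, r.2.1⟩ : Λ.From (x.vertex _ hq))) '' minExt α g.2
  have hv : (x.shift m hm).vertex _ hq' = x.vertex _ hq := by
    have := x.path_seg_congr (le_refl ((p ⊔ m) - m + m)) (le_shift.mp hq') hqm hqm
    exact congrArg Sigma.fst this
  obtain ⟨f, hf, h, e⟩ := hx.exists_of_vertex hq' hv (E := E')
    (hE.biUnion fun g _ => (hΛ α g.2).image _) (by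
      intro g
      obtain ⟨f, hf, ⟨r, hr1, -⟩⟩ := hE' ⟨g.1, α ≫ g.2⟩
      obtain ⟨s, hs, t, ht, -⟩ := minExt_nonempty (f := α) (g := f.2) (s := g.2 ≫ r.2.2) (t := r.2.1)
        (by rw [← Category.assoc]; exact hr1.symm)
      refine ⟨⟨s.1, s.2.1⟩, Set.mem_biUnion hf ⟨s, hs, rfl⟩, ?_⟩
      obtain ⟨u, hu, -⟩ := minExt_nonempty (f := s.2.1) (g := g.2) ht
      exact ⟨u, hu⟩)
  obtain ⟨g, hg, r, hr, rfl⟩ := Set.mem_iUnion₂.mp hf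
  rw [shift_seg] at e
  have hN : (p ⊔ m) - m + Λ.degree r.2.1 + m = (p ⊔ m) + Λ.degree r.2.1 := by
    rw [add_right_comm, hqm]
  have hL := le_shift.mp h
  have hL' : Le ((p ⊔ m) + Λ.degree r.2.1) x := hN ▸ hL
  have e' : path (x.seg (le_self_add : p ⊔ m ≤ (p ⊔ m) + Λ.degree r.2.1) hL') = path r.2.1 := by
    rw [← e]
    exact (x.path_seg_congr _ _ hqm hN).symm
  have e2 := path_comp_congr (f := α) (f' := α) rfl e'
  rw [hα, seg_comp, ← hα, hr.1] at e2
  have hle : p + Λ.degree g.2 ≤ (p ⊔ m) + Λ.degree r.2.1 := by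
    have h1 := degree_congr e2
    rw [degree_seg, Λ.degree_comp] at h1
    have h2 : p ≤ (p ⊔ m) + Λ.degree r.2.1 := le_sup_left.trans le_self_add
    rw [← add_tsub_cancel_of_le h2, h1]
    exact add_le_add_right le_self_add _
  rw [← x.seg_comp (le_self_add : p ≤ p + Λ.degree g.2) hle hL'] at e2
  exact ⟨g, hg, hL'.mono hle, (factor_unique e2 (by rw [degree_seg, add_tsub_cancel_left])).1⟩

end GraphMorphism

open GraphMorphism Topology

variable (Λ) in
/-- The boundary-path space `∂Λ`. -/
def Boundary : Type (max u v) := {x : Λ.GraphMorphism // x.IsBoundary}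

/-- `D_f`, the set of boundary paths `x` with `x(0, d(f)) = f`. -/
def cyl {a b : Λ.Obj} (f : a ⟶ b) : Set Λ.Boundary := {x | x.1.HasInit f}

/-- `D_{fF}`, the union of the sets `D_{fg}` for `g ∈ F`. -/
def cylUnion {a b : Λ.Obj} (f : a ⟶ b) (F : Set (Λ.From b)) : Set Λ.Boundary :=
  ⋃ g ∈ F, cyl (f ≫ g.2)

/-- The topology on `∂Λ` generated by the sets `D_f \ D_{fF}` with `F` finite. -/
instance : TopologicalSpace Λ.Boundary :=
  TopologicalSpace.generateFrom {S | ∃ (a b : Λ.Obj) (f : a ⟶ b) (F : Set (Λ.From b)),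
    F.Finite ∧ S = cyl f \ cylUnion f F}

theorem isOpen_cyl_diff {a b : Λ.Obj} (f : a ⟶ b) {F : Set (Λ.From b)} (hF : F.Finite) :
    IsOpen (cyl f \ cylUnion f F) :=
  TopologicalSpace.isOpen_generateFrom_of_mem ⟨a, b, f, F, hF, rfl⟩

theorem isOpen_cyl {a b : Λ.Obj} (f : a ⟶ b) : IsOpen (cyl f) := by
  simpa [cylUnion] using isOpen_cyl_diff f Set.finite_empty

theorem mem_cyl_id {x : Λ.Boundary} {a : Λ.Obj} :
    x ∈ cyl (𝟙 a) ↔ x.1.vertex 0 (le_zero x.1) = a := by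
  constructor
  · intro h
    exact congrArg Sigma.fst (HasInit.seg_eq h (le_zero x.1) (Λ.degree_id a))
  · rintro rfl
    have := hasInit_seg (le_zero x.1)
    rwa [seg_self] at this

theorem cyl_subset {a b : Λ.Obj} (f : a ⟶ b) : cyl f ⊆ cyl (𝟙 a) := by
  intro x hx
  have : x.1.HasInit (𝟙 a ≫ f) := by rwa [Category.id_comp]
  exact this.of_comp

theorem isClosed_cyl {a b : Λ.Obj} (f : a ⟶ b) : IsClosed (cyl f) := by
  refine ⟨isOpen_iff_forall_mem_open.mpr fun x hx => ?_⟩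
  by_cases h : x ∈ cyl (𝟙 a)
  · have hU : cylUnion (𝟙 a) {(⟨b, f⟩ : Λ.From a)} = cyl f := by simp [cylUnion]
    refine ⟨cyl (𝟙 a) \ cyl f, fun y hy => hy.2, ?_, h, hx⟩
    rw [← hU]
    exact isOpen_cyl_diff _ (Set.finite_singleton _)
  · refine ⟨cyl (𝟙 (x.1.vertex 0 (le_zero x.1))), fun y hy hyf => h ?_, isOpen_cyl _,
      mem_cyl_id.mpr rfl⟩
    rw [mem_cyl_id] at hy ⊢
    exact hy.symm.trans (mem_cyl_id.mp (cyl_subset f hyf))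

theorem isClopen_cyl {a b : Λ.Obj} (f : a ⟶ b) : IsClopen (cyl f) := ⟨isClosed_cyl f, isOpen_cyl f⟩

theorem continuous_of_isClopen {W : Type w} [TopologicalSpace W] {φ : W → Λ.Boundary}
    (h : ∀ {a b : Λ.Obj} (f : a ⟶ b), IsClopen (φ ⁻¹' cyl f)) : Continuous φ := by
  refine continuous_generateFrom_iff.mpr ?_
  rintro _ ⟨a, b, f, F, hF, rfl⟩
  rw [Set.preimage_sdiff, cylUnion, Set.preimage_iUnion₂]
  exact (h f).isOpen.sdiff (hF.isClosed_biUnion fun g _ => (h _).isClosed)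

theorem boundary_ext {x y : Λ.Boundary} (h : ∀ {a b : Λ.Obj} (f : a ⟶ b), x ∈ cyl f → y ∈ cyl f)
    (h' : ∀ {a b : Λ.Obj} (f : a ⟶ b), y ∈ cyl f → x ∈ cyl f) : x = y := by
  have hle : ∀ {x y : Λ.Boundary}, (∀ {a b : Λ.Obj} (f : a ⟶ b), x ∈ cyl f → y ∈ cyl f) →
      ∀ p, Le p x.1 → Le p y.1 := fun {x y} h p hp => by
    obtain ⟨h1, -⟩ := h _ (hasInit_seg hp)
    rwa [degree_seg, tsub_zero] at h1
  refine Subtype.ext (ext_init ?_ fun p hx hy => ?_)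
  · funext i
    refine ENat.eq_of_forall_natCast_le_iff fun n => ?_
    have key : ∀ z : Λ.Boundary, (n : ℕ∞) ≤ z.1.deg i ↔ Le (Pi.single i n) z.1 := fun z => by
      constructor
      · intro hn j
        by_cases hj : j = i
        · subst hj; simpa using hn
        · simp [Pi.single_eq_of_ne hj]
      · intro hn
        simpa using hn i
    rw [key, key]
    exact ⟨hle h _, hle h' _⟩
  · exact ((hasInit_seg hx).unique (h' _ (hasInit_seg hy)) (by rw [degree_seg, degree_seg]))

instance : T2Space Λ.Boundary := by
  refine ⟨fun x y hxy => ?_⟩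
  by_contra hcon
  have key : ∀ x y : Λ.Boundary, (¬ ∃ U V : Set Λ.Boundary, IsOpen U ∧ IsOpen V ∧ x ∈ U ∧ y ∈ V ∧
      Disjoint U V) → ∀ {a b : Λ.Obj} (f : a ⟶ b), x ∈ cyl f → y ∈ cyl f := by
    intro x y hcon a b f hx
    by_contra hy
    exact hcon ⟨cyl f, (cyl f)ᶜ, isOpen_cyl f, (isClosed_cyl f).isOpen_compl, hx, hy,
      disjoint_compl_right⟩
  refine hxy (boundary_ext (key x y hcon) (key y x ?_))
  rintro ⟨U, V, hU, hV, hx, hy, hUV⟩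
  exact hcon ⟨V, U, hV, hU, hy, hx, hUV.symm⟩

variable (Λ) in
/-- `∂Λ^{≥ n}`, the space of boundary paths `x` with `d(x) ≥ n`. -/
abbrev BoundaryGE (n : Fin k → ℕ) : Type (max u v) := {x : Λ.Boundary // Le n x.1}

/-- The shift map `σ_n : ∂Λ^{≥ n} → ∂Λ`. -/
def sigma (n : Fin k → ℕ) (x : Λ.BoundaryGE n) : Λ.Boundary :=
  ⟨x.1.1.shift n x.2, x.1.2.shift n x.2⟩

theorem mem_cyl_comp {n : Fin k → ℕ} (x : Λ.BoundaryGE n) {a b c : Λ.Obj} {f : a ⟶ b} {g : b ⟶ c}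
    (hf : Λ.degree f = n) : x.1 ∈ cyl (f ≫ g) ↔ x.1 ∈ cyl f ∧ sigma n x ∈ cyl g :=
  hasInit_comp_iff x.2 hf

theorem continuous_sigma (n : Fin k → ℕ) : Continuous (sigma (Λ := Λ) n) := by
  refine continuous_of_isClopen fun {c d} g => ⟨⟨?_⟩, ?_⟩
  · refine isOpen_iff_forall_mem_open.mpr fun x hx => ?_
    let f := x.1.1.seg (zero_le (a := n)) x.2
    have hfd : Λ.degree f = n := by rw [degree_seg, tsub_zero]
    have hf : x.1 ∈ cyl f := hasInit_seg x.2
    by_cases hc : x.1.1.vertex n x.2 = c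
    · subst hc
      refine ⟨Subtype.val ⁻¹' (cyl f \ cyl (f ≫ g)), fun y hy hyg => ?_,
        ((isOpen_cyl f).sdiff (isClosed_cyl _)).preimage continuous_subtype_val, hf, fun h => ?_⟩
      · exact hy.2 ((mem_cyl_comp y hfd).mpr ⟨hy.1, hyg⟩)
      · exact hx ((mem_cyl_comp x hfd).mp h).2
    · refine ⟨Subtype.val ⁻¹' cyl f, fun y hy hyg => hc ?_,
        (isOpen_cyl f).preimage continuous_subtype_val, hf⟩
      have h1 : sigma n y ∈ cyl (𝟙 (x.1.1.vertex n x.2)) := by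
        refine ((mem_cyl_comp y hfd).mp ?_).2
        rw [Category.comp_id]; exact hy
      exact (mem_cyl_id.mp h1).symm.trans (mem_cyl_id.mp (cyl_subset g hyg))
  · refine isOpen_iff_forall_mem_open.mpr fun x hx => ?_
    let f := x.1.1.seg (zero_le (a := n)) x.2
    have hfd : Λ.degree f = n := by rw [degree_seg, tsub_zero]
    have hf : x.1 ∈ cyl f := hasInit_seg x.2
    have hv : x.1.1.vertex n x.2 = c := by
      have h1 : sigma n x ∈ cyl (𝟙 (x.1.1.vertex n x.2)) := by
        refine ((mem_cyl_comp x hfd).mp ?_).2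
        rw [Category.comp_id]; exact hf
      exact (mem_cyl_id.mp h1).symm.trans (mem_cyl_id.mp (cyl_subset g hx))
    subst hv
    exact ⟨Subtype.val ⁻¹' cyl (f ≫ g), fun y hy => ((mem_cyl_comp y hfd).mp hy).2,
      (isOpen_cyl _).preimage continuous_subtype_val, (mem_cyl_comp x hfd).mpr ⟨hf, hx⟩⟩

theorem exists_boundary_concat (hΛ : Λ.FinitelyAligned) {n : Fin k → ℕ} {a b : Λ.Obj} (f : a ⟶ b)
    (hf : Λ.degree f = n) (y : Λ.Boundary) (hy : y ∈ cyl (𝟙 b)) :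
    ∃ x : Λ.BoundaryGE n, x.1 ∈ cyl f ∧ sigma n x = y := by
  subst hf
  obtain ⟨x, h, hx, hxy⟩ := exists_concat f y.1 hy
  have hb : x.IsBoundary := IsBoundary.concat hΛ h (by rw [hxy]; exact y.2)
  exact ⟨⟨⟨x, hb⟩, h⟩, hx, Subtype.ext hxy⟩

theorem sigma_inj {n : Fin k → ℕ} {a b : Λ.Obj} {f : a ⟶ b} (hf : Λ.degree f = n)
    {x y : Λ.BoundaryGE n} (hx : x.1 ∈ cyl f) (hy : y.1 ∈ cyl f) (h : sigma n x = sigma n y) :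
    x = y :=
  Subtype.ext (Subtype.ext (ext_shift x.2 y.2
    ((HasInit.seg_eq hx x.2 hf).trans (HasInit.seg_eq hy y.2 hf).symm)
    (congrArg Subtype.val h)))

theorem mem_cyl_iff_minExt {n : Fin k → ℕ} {a b c : Λ.Obj} {f : a ⟶ b} (hf : Λ.degree f = n)
    (g : a ⟶ c) {x : Λ.BoundaryGE n} (hx : x.1 ∈ cyl f) :
    x.1 ∈ cyl g ↔ sigma n x ∈ ⋃ q ∈ minExt f g, cyl q.2.1 := by
  rw [Set.mem_iUnion₂]
  constructor
  · intro hg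
    have hN : Le (Λ.degree f ⊔ Λ.degree g) x.1.1 := fun i => by
      rcases le_total (Λ.degree f i) (Λ.degree g i) with h | h
      · rw [Pi.sup_apply, sup_eq_right.mpr h]; exact hg.1 i
      · rw [Pi.sup_apply, sup_eq_left.mpr h]; exact hx.1 i
    obtain ⟨s, hs⟩ := HasInit.exists_comp hx hN le_sup_left
    obtain ⟨t, ht⟩ := HasInit.exists_comp hg hN le_sup_right
    obtain ⟨q, hq, r, hr, -⟩ := minExt_nonempty (path_inj (hs.trans ht.symm))
    refine ⟨q, hq, ?_⟩
    have h1 : x.1 ∈ cyl (f ≫ s) := (hasInit_seg hN).congr hs.symm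
    have h2 := ((mem_cyl_comp x hf).mp h1).2
    rw [← hr] at h2
    exact HasInit.of_comp h2
  · rintro ⟨q, hq, h⟩
    have h1 : x.1 ∈ cyl (f ≫ q.2.1) := (mem_cyl_comp x hf).mpr ⟨hx, h⟩
    rw [hq.1] at h1
    exact HasInit.of_comp h1

theorem isLocalHomeomorph_sigma (hΛ : Λ.FinitelyAligned) (n : Fin k → ℕ) :
    IsLocalHomeomorph (sigma (Λ := Λ) n) := by
  rw [isLocalHomeomorph_iff_isOpenEmbedding_restrict]
  intro x
  let f := x.1.1.seg (zero_le (a := n)) x.2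
  have hfd : Λ.degree f = n := by rw [degree_seg, tsub_zero]
  have hf : x.1 ∈ cyl f := hasInit_seg x.2
  let U : Set (Λ.BoundaryGE n) := Subtype.val ⁻¹' cyl f
  have hU : IsOpen U := (isOpen_cyl f).preimage continuous_subtype_val
  refine ⟨U, hU.mem_nhds hf, ?_⟩
  have hmem : ∀ y : U, sigma n y.1 ∈ cyl (𝟙 (x.1.1.vertex n x.2)) := fun y => by
    refine ((mem_cyl_comp y.1 hfd).mp ?_).2
    rw [Category.comp_id]; exact y.2
  choose inv hinv using fun y : cyl (𝟙 (x.1.1.vertex n x.2)) =>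
    exists_boundary_concat hΛ f hfd y.1 y.2
  let e : U ≃ₜ cyl (𝟙 (x.1.1.vertex n x.2)) :=
    { toFun := fun y => ⟨sigma n y.1, hmem y⟩
      invFun := fun y => ⟨inv y, (hinv y).1⟩
      left_inv := fun y => Subtype.ext (sigma_inj hfd (hinv _).1 y.2 (hinv _).2)
      right_inv := fun y => Subtype.ext (hinv y).2
      continuous_toFun := ((continuous_sigma n).comp continuous_subtype_val).subtype_mk _
      continuous_invFun := by
        refine Continuous.subtype_mk (Continuous.subtype_mk (continuous_of_isClopen
          fun {c d} g => ?_) _) _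
        by_cases hc : c = x.1.1.vertex 0 (le_zero x.1.1)
        · subst hc
          have : (fun y => (inv y).1) ⁻¹' cyl g
              = Subtype.val ⁻¹' ⋃ q ∈ minExt f g, cyl q.2.1 := by
            ext y
            rw [Set.mem_preimage, mem_cyl_iff_minExt hfd g (hinv y).1, (hinv y).2]
            rfl
          rw [this]
          exact ((hΛ f g).isClopen_biUnion fun q _ => isClopen_cyl _).preimage
            continuous_subtype_val
        · have : (fun y => (inv y).1) ⁻¹' cyl g = ∅ := by
            refine Set.eq_empty_of_forall_notMem fun y hy => hc ?_
            have h1 := mem_cyl_id.mp (cyl_subset g hy)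
            have h2 := mem_cyl_id.mp (cyl_subset f (hinv y).1)
            exact h1.symm.trans h2
          rw [this]
          exact isClopen_empty }
  exact (isOpen_cyl _).isOpenEmbedding_subtypeVal.comp e.isOpenEmbedding

open CompactlySupported ZeroAtInfty

variable (Λ) in
/-- The Hilbert `C₀(∂Λ)`-bimodule `X_n` of the topological graph `(∂Λ, ∂Λ^{≥ n}, σ_n, ι)`, where
`ι` is the inclusion: the completion of `C_c(∂Λ^{≥ n})`. -/
noncomputable def bimodule (hΛ : Λ.FinitelyAligned) (n : Fin k → ℕ) :
    HilbertBimodule C₀(Λ.Boundary, ℂ) :=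
  graphBimodule (isLocalHomeomorph_sigma hΛ n) ⟨Subtype.val, continuous_subtype_val⟩

variable (Λ) in
/-- The canonical map `C_c(∂Λ^{≥ n}) → X_n`. -/
noncomputable def toBimodule (hΛ : Λ.FinitelyAligned) (n : Fin k → ℕ) :
    C_c(Λ.BoundaryGE n, ℂ) →ₗ[ℂ] Λ.bimodule hΛ n :=
  HilbertBimodule.ofPreMk _

/-- The inclusion `∂Λ^{≥ m + n} → ∂Λ^{≥ m}`. -/
def inclGE (m n : Fin k → ℕ) (x : Λ.BoundaryGE (m + n)) : Λ.BoundaryGE m :=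
  ⟨x.1, x.2.mono le_self_add⟩

/-- The map `σ_m : ∂Λ^{≥ m + n} → ∂Λ^{≥ n}`. -/
def sigmaGE (m n : Fin k → ℕ) (x : Λ.BoundaryGE (m + n)) : Λ.BoundaryGE n :=
  ⟨sigma m (inclGE m n x),
    (le_shift (hn := (inclGE m n x).2)).mpr ((add_comm m n) ▸ x.2)⟩

theorem continuous_inclGE (m n : Fin k → ℕ) : Continuous (inclGE (Λ := Λ) m n) :=
  continuous_subtype_val.subtype_mk _

theorem continuous_sigmaGE (m n : Fin k → ℕ) : Continuous (sigmaGE (Λ := Λ) m n) :=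
  ((continuous_sigma m).comp (continuous_inclGE m n)).subtype_mk _

/-- The function `f (g ∘ σ_m) : x ↦ f(x) g(σ_m(x))` in `C_c(∂Λ^{≥ m + n})`, for
`f ∈ C_c(∂Λ^{≥ m})` and `g ∈ C_c(∂Λ^{≥ n})`. -/
noncomputable def piMap {m n : Fin k → ℕ} (f : C_c(Λ.BoundaryGE m, ℂ))
    (g : C_c(Λ.BoundaryGE n, ℂ)) : C_c(Λ.BoundaryGE (m + n), ℂ) where
  toFun x := f (inclGE m n x) * g (sigmaGE m n x)
  continuous_toFun := (f.continuous.comp (continuous_inclGE m n)).mul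
    (g.continuous.comp (continuous_sigmaGE m n))
  hasCompactSupport' := by
    let K : Set (Λ.BoundaryGE m) :=
      tsupport f ∩ sigma m ⁻¹' (Subtype.val '' tsupport g)
    have hK : IsCompact K := f.hasCompactSupport.inter_right
      ((g.hasCompactSupport.image continuous_subtype_val).isClosed.preimage (continuous_sigma m))
    have hind : IsInducing (inclGE (Λ := Λ) m n) :=
      IsInducing.of_comp (continuous_inclGE m n) continuous_subtype_val IsInducing.subtypeVal
    have hrange : K ⊆ Set.range (inclGE (Λ := Λ) m n) := by
      rintro x ⟨-, y, -, hy⟩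
      refine ⟨⟨x.1, ?_⟩, rfl⟩
      have h := y.2
      rw [hy] at h
      rw [add_comm]
      exact (le_shift (hn := x.2)).mp h
    refine HasCompactSupport.intro ((hind.isCompact_preimage_iff hrange).mpr hK) fun x hx => ?_
    by_contra h
    exact hx ⟨subset_closure (left_ne_zero_of_mul h),
      ⟨sigmaGE m n x, subset_closure (right_ne_zero_of_mul h), rfl⟩⟩

end KGraph

/-! On functions the product is `f (g ∘ σ_m)`. Since `σ_{m+n} = σ_n ∘ σ_m`, the fibre of `σ_{m+n}`
over `z` is the disjoint union, over the points `y` of the fibre of `σ_n` over `z`, of the fibres of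
`σ_m` over `y`. On each of these the factors coming from `g` are constant, so the sum defining the
inner product splits: `⟨f (g ∘ σ_m), f' (g' ∘ σ_m)⟩ = ⟨g, ⟨f, f'⟩ · g'⟩` (`inner_piMap`). This is
the inner product of the balanced tensor product, so the product is isometric on `C_c ⊗ C_c`. It
therefore extends to the completions (`exists_bilinear_extension`) and induces an isomorphism onto
`X_{m+n}` as soon as its range is dense (`exists_tensor_iso`). The balancing relations need no
separate check, because vectors of length zero vanish in the completion.

Dense range follows from surjectivity of `π` (`piMap_surjective`). Given `h`, put `g(y) = (∑_{σ_m(x)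
= y} |h(x)|)^{1/2}` and `f = h / (g ∘ σ_m)`. One term of a sum of nonnegative numbers is at most the
sum, hence `|f| ≤ |h|^{1/2}`; this makes `f` continuous also at the zeros of `h`. As `∂Λ^{≥m+n}` is
open in `∂Λ^{≥m}`, `f` extends by zero.

The map `σ_0` is the identity, so `X_0` is a copy of `A` (`exists_iso_self`). Associativity and the
unit laws are pointwise identities for compactly supported functions, and they pass to the
completions by continuity. -/

namespace HilbertBimodule
variable {A : Type u} [NonUnitalCStarAlgebra A]

/-! ### Extending maps from pre-Hilbert bimodules to their completions. -/

section Extension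
variable {T T' : Type*} [AddCommGroup T] [Module ℂ T] [AddCommGroup T'] [Module ℂ T']
  (P : PreHilbertBimodule A T) (Q : PreHilbertBimodule A T')

theorem ofPre_inner_mk (s t : T) :
    (ofPre P).str.inner (ofPreMk P s) (ofPreMk P t) = P.inner s t :=
  P.complInner_coe s t

theorem ofPre_right_mk (a : A) (t : T) :
    (ofPre P).str.right a (ofPreMk P t) = ofPreMk P (P.right a t) :=
  P.complAct_coe P.rightL a t

theorem ofPre_left_mk (a : A) (t : T) :
    (ofPre P).str.left a (ofPreMk P t) = ofPreMk P (P.left a t) :=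
  P.complAct_coe P.leftL a t

theorem denseRange_ofPreMk : DenseRange (ofPreMk P) := P.denseRange_toCompl

theorem norm_eq_sqrt (X : HilbertBimodule A) (x : X) : ‖x‖ = √‖X.str.inner x x‖ := by
  rw [← X.norm_sq, Real.sqrt_sq (norm_nonneg _)]

theorem norm_ofPreMk (t : T) : ‖ofPreMk P t‖ = √‖P.inner t t‖ := by
  rw [norm_eq_sqrt, ofPre_inner_mk]

theorem norm_left_le (X : HilbertBimodule A) (a : A) (x : X) : ‖X.str.left a x‖ ≤ ‖a‖ * ‖x‖ := by
  rw [norm_eq_sqrt, norm_eq_sqrt]; exact X.str.sqrt_inner_left_le a x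

theorem norm_right_le (X : HilbertBimodule A) (a : A) (x : X) :
    ‖X.str.right a x‖ ≤ ‖a‖ * ‖x‖ := by
  rw [norm_eq_sqrt, norm_eq_sqrt]; exact X.str.sqrt_inner_right_le a x

theorem norm_inner_le (X : HilbertBimodule A) (x y : X) : ‖X.str.inner x y‖ ≤ ‖x‖ * ‖y‖ := by
  rw [norm_eq_sqrt, norm_eq_sqrt]; exact X.str.cauchy_schwarz x y

/-- Joint continuity is needed: in `⟨y, ⟨x, x'⟩ · y'⟩` the acting element of `A` itself varies with
`x` and `x'`. -/
theorem continuous_left₂ (X : HilbertBimodule A) {W : Type*} [TopologicalSpace W]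
    {a : W → A} {f : W → X} (ha : Continuous a) (hf : Continuous f) :
    Continuous fun x => X.str.left (a x) (f x) := by
  let L : A →L[ℂ] X →L[ℂ] X := X.str.left.mkContinuous₂ 1 fun a x => by
    rw [one_mul]; exact X.norm_left_le a x
  have : Continuous fun x => L (a x) (f x) := by fun_prop
  exact this

theorem continuous_left (X : HilbertBimodule A) {W : Type*} [TopologicalSpace W] (a : A)
    {f : W → X} (hf : Continuous f) : Continuous fun x => X.str.left a (f x) :=
  X.continuous_left₂ continuous_const hf

theorem continuous_right₂ (X : HilbertBimodule A) {W : Type*} [TopologicalSpace W]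
    {a : W → A} {f : W → X} (ha : Continuous a) (hf : Continuous f) :
    Continuous fun x => X.str.right (a x) (f x) := by
  let R : A →L[ℂ] X →L[ℂ] X := X.str.right.mkContinuous₂ 1 fun a x => by
    rw [one_mul]; exact X.norm_right_le a x
  have : Continuous fun x => R (a x) (f x) := by fun_prop
  exact this

theorem continuous_right (X : HilbertBimodule A) {W : Type*} [TopologicalSpace W] (a : A)
    {f : W → X} (hf : Continuous f) : Continuous fun x => X.str.right a (f x) :=
  X.continuous_right₂ continuous_const hf

theorem continuous_inner (X : HilbertBimodule A) {W : Type*} [TopologicalSpace W]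
    {f g : W → X} (hf : Continuous f) (hg : Continuous g) :
    Continuous fun x => X.str.inner (f x) (g x) := by
  let I : X →L⋆[ℂ] X →L[ℂ] A := X.str.inner.mkContinuous₂ 1 fun x y => by
    rw [one_mul]; exact X.norm_inner_le x y
  have : Continuous fun x => I (f x) (g x) := by fun_prop
  exact this

/-- A closed property which holds on a pre-Hilbert bimodule holds on its completion. -/
@[elab_as_elim]
theorem ofPre_induction {p : ofPre P → Prop} (x : ofPre P) (hp : IsClosed {x | p x})
    (h : ∀ t, p (ofPreMk P t)) : p x :=
  P.compl_induction hp h x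

/-- A linear map with dense range from a pre-Hilbert bimodule to a Hilbert bimodule which
preserves the inner products and the actions extends to an isomorphism from the completion. -/
theorem exists_iso_of_denseRange (Y : HilbertBimodule A) (φ : T →ₗ[ℂ] Y)
    (hin : ∀ s t, Y.str.inner (φ s) (φ t) = P.inner s t)
    (hr : ∀ t a, φ (P.right a t) = Y.str.right a (φ t))
    (hl : ∀ a t, φ (P.left a t) = Y.str.left a (φ t)) (hd : DenseRange φ) :
    ∃ Φ : Iso (ofPre P) Y, ∀ t, Φ.toFun (ofPreMk P t) = φ t := by
  have hnorm : ∀ t, ‖φ t‖ = ‖ofPreMk P t‖ := fun t => by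
    rw [norm_eq_sqrt, hin, norm_ofPreMk]
  let φL : P.Space →L[ℂ] Y := LinearMap.mkContinuous (φ : P.Space →ₗ[ℂ] Y) 1 fun t => by
    rw [one_mul]; exact (hnorm t).le.trans (norm_ofPreMk P t).le
  let E : ofPre P →L[ℂ] Y := φL.extend P.toCompl
  have hE : ∀ t, E (ofPreMk P t) = φ t := fun t =>
    ContinuousLinearMap.extend_eq φL P.denseRange_toCompl P.isUniformInducing_toCompl t
  have hEc : Continuous E := E.continuous
  have hEn : ∀ x, ‖E x‖ = ‖x‖ := fun x => by
    induction x using ofPre_induction P with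
    | hp =>
      exact isClosed_eq hEc.norm continuous_norm
    | h t => rw [hE, hnorm]
  have hiso : Isometry E := AddMonoidHomClass.isometry_of_norm E hEn
  have hsurj : Function.Surjective E := by
    -- An isometry defined on a complete space has closed range, and this range contains the dense
    -- range of `φ`.
    have h1 : IsClosed (Set.range E) := hiso.isClosedEmbedding.isClosed_range
    have h2 : DenseRange E := hd.mono (by rintro _ ⟨t, rfl⟩; exact ⟨_, hE t⟩)
    exact Set.range_eq_univ.mp (h1.closure_eq ▸ h2.closure_range)
  refine ⟨{ LinearEquiv.ofBijective E.toLinearMap ⟨hiso.injective, hsurj⟩ with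
    map_inner := ?_, map_right := ?_, map_left := ?_ }, hE⟩
  · change ∀ x x', Y.str.inner (E x) (E x') = (ofPre P).str.inner x x'
    intro x x'
    induction x using ofPre_induction P with
    | hp =>
      exact isClosed_eq (Y.continuous_inner hEc continuous_const)
        (continuous_inner _ continuous_id continuous_const)
    | h s =>
      induction x' using ofPre_induction P with
      | hp =>
        exact isClosed_eq (Y.continuous_inner continuous_const hEc)
          (continuous_inner _ continuous_const continuous_id)
      | h t => rw [hE, hE, hin, ofPre_inner_mk]
  · change ∀ x a, E ((ofPre P).str.right a x) = Y.str.right a (E x)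
    intro x a
    induction x using ofPre_induction P with
    | hp =>
      exact isClosed_eq (hEc.comp (continuous_right _ a continuous_id))
        (Y.continuous_right a hEc)
    | h t => rw [ofPre_right_mk, hE, hE, hr]
  · change ∀ a x, E ((ofPre P).str.left a x) = Y.str.left a (E x)
    intro a x
    induction x using ofPre_induction P with
    | hp =>
      exact isClosed_eq (hEc.comp (continuous_left _ a continuous_id))
        (Y.continuous_left a hEc)
    | h t => rw [ofPre_left_mk, hE, hE, hl]

/-- A bilinear map compatible with the inner product of the balanced tensor product extends to
a continuous bilinear map on the completions. -/
theorem exists_bilinear_extension (Y : HilbertBimodule A) (B : T →ₗ[ℂ] T' →ₗ[ℂ] Y)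
    (hB : ∀ t s t' s', Y.str.inner (B t s) (B t' s') = Q.inner s (Q.left (P.inner t t') s')) :
    ∃ M : ofPre P →L[ℂ] ofPre Q →L[ℂ] Y, ∀ t s, M (ofPreMk P t) (ofPreMk Q s) = B t s := by
  -- By Cauchy–Schwarz, `‖B t s‖² = ‖⟨s, ⟨t, t⟩ · s⟩‖ ≤ ‖s‖ ‖⟨t, t⟩‖ ‖s‖ = ‖t‖² ‖s‖²`.
  have hbound : ∀ t s, ‖B t s‖ ≤ ‖ofPreMk P t‖ * ‖ofPreMk Q s‖ := fun t s => by
    have e : Y.str.inner (B t s) (B t s) = (ofPre Q).str.inner (ofPreMk Q s)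
        ((ofPre Q).str.left ((ofPre P).str.inner (ofPreMk P t) (ofPreMk P t)) (ofPreMk Q s)) := by
      rw [hB, ofPre_inner_mk, ofPre_left_mk, ofPre_inner_mk]
    refine (sq_le_sq₀ (norm_nonneg _) (by positivity)).mp ?_
    rw [Y.norm_sq, e]
    calc _ ≤ _ := norm_inner_le (ofPre Q) _ _
      _ ≤ ‖ofPreMk Q s‖ * (‖(ofPre P).str.inner (ofPreMk P t) (ofPreMk P t)‖ * ‖ofPreMk Q s‖) :=
        mul_le_mul_of_nonneg_left (norm_left_le (ofPre Q) _ _) (norm_nonneg (ofPreMk Q s))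
      _ = _ := by rw [← (ofPre P).norm_sq]; ring
  let BL : P.Space →L[ℂ] Q.Space →L[ℂ] Y :=
    LinearMap.mkContinuous₂ (B : P.Space →ₗ[ℂ] Q.Space →ₗ[ℂ] Y) 1 fun t s => by
      rw [one_mul]
      exact (hbound t s).trans_eq (congrArg₂ (· * ·) (norm_ofPreMk P t) (norm_ofPreMk Q s))
  -- The variables are extended one at a time; `flip` brings the remaining one to the front.
  refine ⟨((BL.extend P.toCompl).flip.extend Q.toCompl).flip, fun t s => ?_⟩
  have key : ∀ (t : P.Space) (s : Q.Space),
      ((BL.extend P.toCompl).flip.extend Q.toCompl).flip (P.toCompl t) (Q.toCompl s)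
        = BL t s := fun t s => by
    rw [ContinuousLinearMap.flip_apply,
      ContinuousLinearMap.extend_eq _ Q.denseRange_toCompl Q.isUniformInducing_toCompl,
      ContinuousLinearMap.flip_apply,
      ContinuousLinearMap.extend_eq _ P.denseRange_toCompl P.isUniformInducing_toCompl]
  exact key t s

/-- A bilinear map which is compatible with the inner product of the balanced tensor product and
with the outer actions, and which has dense range, induces an isomorphism from the balanced tensor
product of the completions. -/
theorem exists_tensor_iso (Y : HilbertBimodule A) (B : T →ₗ[ℂ] T' →ₗ[ℂ] Y)
    (hB : ∀ t s t' s', Y.str.inner (B t s) (B t' s') = Q.inner s (Q.left (P.inner t t') s'))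
    (hr : ∀ t s a, B t (Q.right a s) = Y.str.right a (B t s))
    (hl : ∀ a t s, B (P.left a t) s = Y.str.left a (B t s))
    (hd : DenseRange fun p : T × T' => B p.1 p.2) :
    ∃ M : ofPre P →L[ℂ] ofPre Q →L[ℂ] Y, (∀ t s, M (ofPreMk P t) (ofPreMk Q s) = B t s) ∧
      ∃ Φ : Iso ((ofPre P).tensor (ofPre Q)) Y, ∀ x y, Φ.toFun (tmul _ _ x y) = M x y := by
  obtain ⟨M, hM⟩ := exists_bilinear_extension P Q Y B hB
  refine ⟨M, hM, ?_⟩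
  -- Both sides are continuous in each variable separately, so the four variables can be replaced by
  -- elements of the dense subspaces one after the other.
  have hMin : ∀ x y x' y', Y.str.inner (M x y) (M x' y')
      = (ofPre Q).str.inner y ((ofPre Q).str.left ((ofPre P).str.inner x x') y') := by
    intro x y x' y'
    induction x using ofPre_induction P with
    | hp =>
      exact isClosed_eq (Y.continuous_inner (by fun_prop) continuous_const)
        (continuous_inner _ continuous_const (continuous_left₂ _ (continuous_inner _
          continuous_id continuous_const) continuous_const))
    | h t =>
    induction y using ofPre_induction Q with
    | hp =>
      exact isClosed_eq (Y.continuous_inner (by fun_prop) continuous_const)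
        (continuous_inner _ continuous_id continuous_const)
    | h s =>
    induction x' using ofPre_induction P with
    | hp =>
      exact isClosed_eq (Y.continuous_inner continuous_const (by fun_prop))
        (continuous_inner _ continuous_const (continuous_left₂ _ (continuous_inner _
          continuous_const continuous_id) continuous_const))
    | h t' =>
    induction y' using ofPre_induction Q with
    | hp =>
      exact isClosed_eq (Y.continuous_inner continuous_const (by fun_prop))
        (continuous_inner _ continuous_const (continuous_left _ _ continuous_id))
    | h s' => rw [hM, hM, hB, ofPre_inner_mk, ofPre_left_mk, ofPre_inner_mk]
  have hMr : ∀ x y a, M x ((ofPre Q).str.right a y) = Y.str.right a (M x y) := by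
    intro x y a
    induction x using ofPre_induction P with
    | hp =>
      exact isClosed_eq (by fun_prop) (Y.continuous_right a (by fun_prop))
    | h t =>
    induction y using ofPre_induction Q with
    | hp =>
      exact isClosed_eq ((M _).continuous.comp (continuous_right _ a continuous_id))
        (Y.continuous_right a (by fun_prop))
    | h s => rw [ofPre_right_mk, hM, hM, hr]
  have hMl : ∀ a x y, M ((ofPre P).str.left a x) y = Y.str.left a (M x y) := by
    intro a x y
    induction y using ofPre_induction Q with
    | hp =>
      exact isClosed_eq (by fun_prop) (Y.continuous_left a (by fun_prop))
    | h s =>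
    induction x using ofPre_induction P with
    | hp =>
      exact isClosed_eq ((M.flip _).continuous.comp (continuous_left _ a continuous_id))
        (Y.continuous_left a (M.flip _).continuous)
    | h t => rw [ofPre_left_mk, hM, hM, hl]
  -- The balanced tensor product is the completion of the algebraic one over `ℂ`, so an isometric
  -- linear map on the latter is all that is required.
  obtain ⟨Φ, hΦ⟩ := exists_iso_of_denseRange (tensorPre (ofPre P) (ofPre Q)) Y
    (TensorProduct.lift M.toLinearMap₁₂)
    (tensorInner_ext _ _ (by simp) (by simp) (by simp) (by simp) fun x y x' y' => hMin x y x' y')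
    (fun t a => by
      induction t with
      | zero => simp
      | add s t hs ht => simp only [map_add, hs, ht]
      | tmul x y => exact hMr x y a)
    (fun a t => by
      induction t with
      | zero => simp
      | add s t hs ht => simp only [map_add, hs, ht]
      | tmul x y => exact hMl a x y)
    (hd.mono (by rintro _ ⟨⟨t, s⟩, rfl⟩; exact ⟨_ ⊗ₜ _, hM t s⟩))
  exact ⟨Φ, fun x y => hΦ _⟩

/-- The inverse of an isomorphism of Hilbert bimodules. -/
noncomputable def Iso.symm {X : HilbertBimodule.{u, v} A} {Y : HilbertBimodule.{u, w} A}
    (Φ : Iso X Y) : Iso Y X where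
  toLinearEquiv := Φ.toLinearEquiv.symm
  map_inner y y' := by
    obtain ⟨x, rfl⟩ := Φ.toLinearEquiv.surjective y
    obtain ⟨x', rfl⟩ := Φ.toLinearEquiv.surjective y'
    have := Φ.map_inner x x'
    simp_all
  map_right y a := by
    obtain ⟨x, rfl⟩ := Φ.toLinearEquiv.surjective y
    refine Φ.toLinearEquiv.injective ?_
    have := Φ.map_right x a
    simp_all
  map_left a y := by
    obtain ⟨x, rfl⟩ := Φ.toLinearEquiv.surjective y
    refine Φ.toLinearEquiv.injective ?_
    have := Φ.map_left a x
    simp_all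

end Extension

end HilbertBimodule

/-! ### Sums over fibres of a composite map. -/

section Fibre
variable {Y : Type u} {Z : Type v} {W : Type w}

/-- The fibre of `t ∘ s` over `z` is partitioned by the value of `s`. The finiteness hypothesis is
what permits regrouping, since a `finsum` with infinite support is `0` by convention. -/
theorem fibreSum_comp (s : Y → W) (t : W → Z) (F : Y → ℂ) (z : Z)
    (hF : ((t ∘ s) ⁻¹' {z} ∩ Function.support F).Finite) :
    fibreSum (t ∘ s) F z = fibreSum t (fibreSum s F) z := by
  classical
  -- A point `w` contributes only if `F` is nonzero somewhere above it, so the outer sum runs over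
  -- the image of a finite set.
  have h1 : fibreSum t (fibreSum s F) z = ∑ w ∈ hF.toFinset.image s, fibreSum s F w := by
    refine finsum_mem_eq_sum_of_subset _ ?_ ?_
    · rintro w ⟨hw, hw0⟩
      obtain ⟨y, hy, hy0⟩ := exists_ne_zero_of_finsum_mem_ne_zero hw0
      have hyw : s y = w := hy
      simp only [Finset.coe_image, Set.Finite.coe_toFinset]
      exact ⟨y, ⟨by simpa [hyw] using hw, hy0⟩, hyw⟩
    · intro w hw
      simp only [Finset.coe_image, Set.Finite.coe_toFinset] at hw
      obtain ⟨y, hy, rfl⟩ := hw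
      exact hy.1
  rw [h1, fibreSum, finsum_mem_eq_sum F hF,
    ← Finset.sum_fiberwise_of_maps_to (fun y hy => Finset.mem_image_of_mem s hy)]
  refine Finset.sum_congr rfl fun w hw => ?_
  obtain ⟨y, hy, rfl⟩ := Finset.mem_image.mp hw
  have hyz : t (s y) = z := (hF.mem_toFinset.mp hy).1
  symm
  refine finsum_mem_eq_sum_of_subset _ ?_ ?_
  · rintro y' ⟨hy', h0⟩
    have hy's : s y' = s y := hy'
    simp only [Finset.coe_filter, Set.Finite.mem_toFinset]
    exact ⟨⟨by simp [hy's, hyz], h0⟩, hy's⟩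
  · intro y' hy'
    exact (Finset.mem_filter.mp hy').2

/-- The factor `G ∘ s` has the constant value `G z` on the fibre over `z`. -/
theorem fibreSum_mul_left (s : Y → Z) (F : Y → ℂ) (G : Z → ℂ) (z : Z) :
    fibreSum s (fun y => G (s y) * F y) z = G z * fibreSum s F z := by
  rw [fibreSum, fibreSum, mul_finsum_mem]
  refine finsum_mem_congr rfl fun y hy => ?_
  rw [show s y = z from hy]

end Fibre

/-! ### Composition of shifts, and the restricted shifts between the spaces `∂Λ^{≥ n}`. -/

namespace KGraph
open GraphMorphism Topology CompactlySupported ZeroAtInfty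
variable {k : ℕ} {Λ : KGraph.{u, v} k}

theorem shift_shift (x : Λ.GraphMorphism) {m n : Fin k → ℕ} (hm : Le m x)
    (hn : Le n (x.shift m hm)) (hmn : Le (m + n) x) :
    (x.shift m hm).shift n hn = x.shift (m + n) hmn := by
  refine ext_init ?_ fun p hp hp' => ?_
  · funext i
    change x.deg i - m i - n i = x.deg i - ((m i + n i : ℕ) : ℕ∞)
    rw [Nat.cast_add, tsub_tsub]
  · rw [shift_seg, shift_seg, shift_seg]
    exact x.path_seg_congr _ _ (by abel) (by abel)

theorem shift_zero (x : Λ.GraphMorphism) : x.shift 0 (le_zero x) = x := by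
  refine ext_init ?_ fun p hp hp' => ?_
  · funext i
    change x.deg i - ((0 : ℕ) : ℕ∞) = x.deg i
    simp
  · exact shift_seg _ _

theorem sigma_zero (x : Λ.BoundaryGE 0) : sigma 0 x = x.1 := Subtype.ext (shift_zero _)

/-- This cocycle relation is the source of the inner product formula, of compatibility with the
right action, and of associativity. -/
theorem sigma_sigmaGE (m n : Fin k → ℕ) (x : Λ.BoundaryGE (m + n)) :
    sigma n (sigmaGE m n x) = sigma (m + n) x :=
  Subtype.ext (shift_shift x.1.1 (inclGE m n x).2 (sigmaGE m n x).2 x.2)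

/-- If `d(x) ≥ n` and `λ = x(0, n)`, every path in the open set `D_λ` also has degree at least `n`.
-/
theorem isOpen_setOf_le (n : Fin k → ℕ) : IsOpen {x : Λ.Boundary | Le n x.1} := by
  refine isOpen_iff_forall_mem_open.mpr fun x hx => ?_
  refine ⟨cyl (x.1.seg (zero_le (a := n)) hx), fun y hy => ?_, isOpen_cyl _, hasInit_seg hx⟩
  obtain ⟨h, -⟩ := hy
  rwa [degree_seg, tsub_zero] at h

theorem isOpenEmbedding_inclGE (m n : Fin k → ℕ) :
    IsOpenEmbedding (inclGE (Λ := Λ) m n) :=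
  .of_comp _ (isOpen_setOf_le m).isOpenEmbedding_subtypeVal
    (isOpen_setOf_le (m + n)).isOpenEmbedding_subtypeVal

/-- Followed by the open inclusion of `∂Λ^{≥ n}` in `∂Λ`, this map is the restriction of the local
homeomorphism `σ_m` to an open set. Being continuous, it inherits the property. -/
theorem isLocalHomeomorph_sigmaGE (hΛ : Λ.FinitelyAligned) (m n : Fin k → ℕ) :
    IsLocalHomeomorph (sigmaGE (Λ := Λ) m n) :=
  .of_comp (g := Subtype.val)
    ((isLocalHomeomorph_sigma hΛ m).comp (isOpenEmbedding_inclGE m n).isLocalHomeomorph)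
    (isOpen_setOf_le n).isOpenEmbedding_subtypeVal.isLocalHomeomorph (continuous_sigmaGE m n)

/-- If `σ_m(x) = y` and `d(y) ≥ n`, then automatically `d(x) ≥ m + n`. So restricting `σ_m` to
`∂Λ^{≥ m+n}` removes no point from the fibres over `∂Λ^{≥ n}`, and the fibre sums agree. -/
theorem sigma_preimage_eq_image (m n : Fin k → ℕ) (y : Λ.BoundaryGE n) :
    sigma m ⁻¹' {y.1} = inclGE m n '' (sigmaGE m n ⁻¹' {y}) := by
  ext x
  constructor
  · intro hx
    have hxy : sigma m x = y.1 := hx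
    have hle : Le (m + n) x.1.1 := by
      have h := y.2
      rw [← hxy] at h
      rw [add_comm]
      exact (le_shift (hn := x.2)).mp h
    exact ⟨⟨x.1, hle⟩, Subtype.ext hxy, rfl⟩
  · rintro ⟨x, hx, rfl⟩
    exact congrArg Subtype.val (show sigmaGE m n x = y from hx)

theorem fibreSum_sigmaGE (m n : Fin k → ℕ) (F : Λ.BoundaryGE m → ℂ) (y : Λ.BoundaryGE n) :
    fibreSum (sigmaGE m n) (F ∘ inclGE m n) y = fibreSum (sigma m) F y.1 := by
  rw [fibreSum, fibreSum, sigma_preimage_eq_image,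
    finsum_mem_image (isOpenEmbedding_inclGE m n).injective.injOn]
  rfl

theorem fibreSum_sigma_add (hΛ : Λ.FinitelyAligned) (m n : Fin k → ℕ)
    (F : C_c(Λ.BoundaryGE (m + n), ℂ)) (z : Λ.Boundary) :
    fibreSum (sigma (m + n)) F z = fibreSum (sigma n) (fibreSum (sigmaGE m n) F) z := by
  have h : sigma (m + n) = sigma n ∘ sigmaGE (Λ := Λ) m n :=
    funext fun x => (sigma_sigmaGE m n x).symm
  have hfin := fibre_finite' (isLocalHomeomorph_sigma hΛ (m + n)) F z
  rw [h] at hfin ⊢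
  exact fibreSum_comp _ _ _ _ hfin

/-- Because `σ_0` is the identity, its fibres are single points. -/
theorem fibreSum_sigma_zero (F : Λ.BoundaryGE 0 → ℂ) (z : Λ.Boundary) :
    fibreSum (sigma 0) F z = F ⟨z, le_zero z.1⟩ := by
  have : sigma 0 ⁻¹' {z} = {(⟨z, le_zero z.1⟩ : Λ.BoundaryGE 0)} := by
    ext x
    simp [sigma_zero, Subtype.ext_iff]
  rw [fibreSum, this, finsum_mem_singleton]

/-! ### Surjectivity of `π`. -/

theorem norm_le_fibreSum_norm (hΛ : Λ.FinitelyAligned) (m n : Fin k → ℕ)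
    (N : C_c(Λ.BoundaryGE (m + n), ℂ)) (hN : ∀ x, 0 ≤ N x) (x : Λ.BoundaryGE (m + n)) :
    N x ≤ fibreSum (sigmaGE m n) N (sigmaGE m n x) := by
  rw [fibreSum, finsum_mem_def]
  have hx : N x = Set.indicator (sigmaGE m n ⁻¹' {sigmaGE m n x}) N x :=
    (Set.indicator_of_mem (by simp) _).symm
  rw [hx]
  -- Finiteness of the support on the fibre comes from compact support of `N`; without it the sum
  -- could take the default value `0`.
  refine single_le_finsum x ?_ fun y => Set.indicator_nonneg (fun y _ => hN y) y
  have := fibre_finite' (isLocalHomeomorph_sigmaGE hΛ m n) N (sigmaGE m n x)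
  rwa [← Set.support_indicator] at this

/-- A factor `g` with `|h|^{1/2} ≤ g ∘ σ_m` is sought, so that the quotient `h / (g ∘ σ_m)` tends to
zero wherever `h` does. Summing `|h|` over the fibres before taking the root provides one that is
continuous and compactly supported, with no need for cut-off functions. -/
theorem piMap_surjective (hΛ : Λ.FinitelyAligned) (m n : Fin k → ℕ) :
    Function.Surjective (fun fg : C_c(Λ.BoundaryGE m, ℂ) × C_c(Λ.BoundaryGE n, ℂ) =>
      piMap fg.1 fg.2) := by
  intro h
  let N : C_c(Λ.BoundaryGE (m + n), ℂ) :=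
    { toFun := fun x => (‖h x‖ : ℂ)
      continuous_toFun := by fun_prop
      hasCompactSupport' := h.hasCompactSupport.comp_left (g := fun w : ℂ => (‖w‖ : ℂ)) (by simp) }
  have hloc := isLocalHomeomorph_sigmaGE hΛ m n
  have hcont : Continuous (fibreSum (sigmaGE m n) N) := continuous_fibreSum hloc N
  let ρ : Λ.BoundaryGE n → ℝ := fun y => √(fibreSum (sigmaGE m n) N y).re
  have hρ : Continuous ρ := by fun_prop
  let g : C_c(Λ.BoundaryGE n, ℂ) :=
    { toFun := fun y => (ρ y : ℂ)
      continuous_toFun := by fun_prop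
      hasCompactSupport' := by
        refine HasCompactSupport.intro (N.hasCompactSupport.image hloc.continuous) fun y hy => ?_
        have : fibreSum (sigmaGE m n) N y = 0 :=
          finsum_mem_eq_zero_of_forall_eq_zero fun x hx => by
            by_contra h0
            exact hy ⟨x, subset_closure h0, hx⟩
        simp [ρ, this] }
  have hle : ∀ x, √‖h x‖ ≤ ρ (sigmaGE m n x) := fun x => by
    have h1 := norm_le_fibreSum_norm hΛ m n N
      (fun x => by simp [N]) x
    exact Real.sqrt_le_sqrt (Complex.le_def.mp h1).1
  -- Where the denominator vanishes so does `h`, by `hle`, and the convention `0 / 0 = 0` gives the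
  -- right value.
  let F : Λ.BoundaryGE (m + n) → ℂ := fun x => h x / ρ (sigmaGE m n x)
  have hFle : ∀ x, ‖F x‖ ≤ √‖h x‖ := fun x => by
    have h0 := hle x
    simp only [F, norm_div, Complex.norm_real, Real.norm_eq_abs, abs_of_nonneg (Real.sqrt_nonneg _), ρ]
    refine div_le_of_le_mul₀ (Real.sqrt_nonneg _) (Real.sqrt_nonneg _) ?_
    calc ‖h x‖ = √‖h x‖ * √‖h x‖ := (Real.mul_self_sqrt (norm_nonneg _)).symm
      _ ≤ _ := mul_le_mul_of_nonneg_left h0 (Real.sqrt_nonneg _)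
  have hF : Continuous F := by
    rw [continuous_iff_continuousAt]
    intro x
    -- At a zero of `h` continuity follows by squeezing with `|F| ≤ |h|^{1/2}`; elsewhere the
    -- denominator is positive.
    by_cases hx : h x = 0
    · have hFx : F x = 0 := by simp [F, hx]
      rw [ContinuousAt, hFx]
      refine squeeze_zero_norm hFle ?_
      have : Continuous fun x => √‖h x‖ := by fun_prop
      simpa [hx] using this.tendsto x
    · have hpos : 0 < ρ (sigmaGE m n x) :=
        (Real.sqrt_pos.mpr (norm_pos_iff.mpr hx)).trans_le (hle x)
      refine h.continuous.continuousAt.div ?_ (by exact_mod_cast hpos.ne')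
      exact (Complex.continuous_ofReal.comp (hρ.comp hloc.continuous)).continuousAt
  have hFs : HasCompactSupport F := by
    refine HasCompactSupport.intro h.hasCompactSupport fun x hx => ?_
    simp [F, image_eq_zero_of_notMem_tsupport hx]
  have hemb := isOpenEmbedding_inclGE (Λ := Λ) m n
  -- Extension by zero from the open subset `∂Λ^{≥ m+n}` of `∂Λ^{≥ m}`.
  let G : Λ.BoundaryGE m → ℂ := Function.extend (inclGE m n) F 0
  have hG : ∀ x, G (inclGE m n x) = F x := hemb.injective.extend_apply _ _
  have hG0 : ∀ y, y ∉ Set.range (inclGE m n) → G y = 0 := fun y hy =>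
    Function.extend_apply' _ _ y hy
  let f : C_c(Λ.BoundaryGE m, ℂ) :=
    { toFun := G
      continuous_toFun := by
        rw [continuous_iff_continuousAt]
        intro x
        by_cases hx : x ∈ Set.range (inclGE m n)
        · obtain ⟨x, rfl⟩ := hx
          rw [← hemb.continuousAt_iff, show G ∘ inclGE m n = F from funext hG]
          exact hF.continuousAt
        -- The support of `F` stays compact, hence closed, in the larger Hausdorff space, so a point
        -- outside the subset has a neighbourhood on which `G` vanishes.
        · have hK : IsClosed (inclGE m n '' tsupport F) := (hFs.isCompact.image hemb.continuous).isClosed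
          refine continuousAt_const.congr (f := fun _ => (0 : ℂ)) ?_
          filter_upwards [hK.isOpen_compl.mem_nhds fun h => hx (Set.image_subset_range _ _ h)]
            with y hy
          by_cases hyr : y ∈ Set.range (inclGE m n)
          · obtain ⟨y, rfl⟩ := hyr
            rw [hG]
            exact (image_eq_zero_of_notMem_tsupport fun h => hy ⟨y, h, rfl⟩).symm
          · exact (hG0 y hyr).symm
      hasCompactSupport' := by
        refine HasCompactSupport.intro (hFs.isCompact.image hemb.continuous) fun y hy => ?_
        by_cases hyr : y ∈ Set.range (inclGE m n)
        · obtain ⟨y, rfl⟩ := hyr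
          rw [hG]
          exact image_eq_zero_of_notMem_tsupport fun h => hy ⟨y, h, rfl⟩
        · exact hG0 y hyr }
  refine ⟨(f, g), ?_⟩
  ext x
  change G (inclGE m n x) * (ρ (sigmaGE m n x) : ℂ) = h x
  rw [hG]
  -- The case split avoids cancelling a denominator that may be zero.
  by_cases hx : h x = 0
  · simp [F, hx]
  · have hpos : 0 < ρ (sigmaGE m n x) :=
      (Real.sqrt_pos.mpr (norm_pos_iff.mpr hx)).trans_le (hle x)
    exact div_mul_cancel₀ _ (by exact_mod_cast hpos.ne')

end KGraph

/-! ### Density and closedness tools for passing to completions. -/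

namespace HilbertBimodule
variable {A : Type u} [NonUnitalCStarAlgebra A]

theorem Iso.isometry {X : HilbertBimodule.{u, v} A} {Y : HilbertBimodule.{u, w} A}
    (Φ : Iso X Y) : Isometry Φ.toLinearEquiv :=
  AddMonoidHomClass.isometry_of_norm _ fun x => by
    have h : ‖Y.str.inner (Φ.toLinearEquiv x) (Φ.toLinearEquiv x)‖ = ‖X.str.inner x x‖ :=
      congrArg norm (Φ.map_inner x x)
    rw [norm_eq_sqrt, norm_eq_sqrt, h]

end HilbertBimodule

/-- Compactly supported continuous functions are dense among the functions vanishing at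
infinity. -/
theorem ZeroAtInftyContinuousMap.exists_compactlySupported_approx {Z : Type*} [TopologicalSpace Z]
    [T2Space Z] (a : C₀(Z, ℂ)) {ε : ℝ} (hε : 0 < ε) :
    ∃ f : C_c(Z, ℂ), ∀ z, ‖a z - f z‖ ≤ ε := by
  have hmax : ∀ z, 0 < max ‖a z‖ ε := fun z => hε.trans_le (le_max_right _ _)
  obtain ⟨K, hK, hKa⟩ := Filter.mem_cocompact.mp
    (a.zero_at_infty' (Metric.ball_mem_nhds (0 : ℂ) hε))
  -- Soft thresholding: the modulus of `a` is lowered to `max (|a| - ε) 0` and the phase is kept.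
  -- The denominator equals `|a|` where the numerator is nonzero and is bounded below by `ε`, so the
  -- quotient is continuous. Local compactness of `Z` is not needed.
  refine ⟨{ toFun := fun z => a z * ((max (‖a z‖ - ε) 0 / max ‖a z‖ ε : ℝ) : ℂ)
            continuous_toFun := ?_
            hasCompactSupport' := ?_ }, fun z => ?_⟩
  · refine a.continuous.mul (Complex.continuous_ofReal.comp (Continuous.div ?_ ?_ fun z =>
      (hmax z).ne')) <;> fun_prop
  · refine HasCompactSupport.intro hK fun z hz => ?_
    have h : ‖a z‖ < ε := by simpa using hKa hz
    simp [max_eq_right (sub_nonpos.mpr h.le)]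
  · change ‖a z - a z * ((max (‖a z‖ - ε) 0 / max ‖a z‖ ε : ℝ) : ℂ)‖ ≤ ε
    rcases le_total ‖a z‖ ε with h | h
    · simpa [max_eq_right (sub_nonpos.mpr h)] using h
    · have h0 : 0 < ‖a z‖ := hε.trans_le h
      have e : a z - a z * ((max (‖a z‖ - ε) 0 / max ‖a z‖ ε : ℝ) : ℂ)
          = a z * ((ε / ‖a z‖ : ℝ) : ℂ) := by
        rw [max_eq_left h, max_eq_left (sub_nonneg.mpr h), sub_div, div_self h0.ne']
        push_cast
        ring
      rw [e, norm_mul, Complex.norm_real, Real.norm_of_nonneg (by positivity),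
        mul_div_cancel₀ _ h0.ne']

/-- The product-system laws compare elements of fibres such as `X_{(p+q)+r}` and `X_{p+(q+r)}`,
whose indices are equal only by a proof. Once the indices are identified this is closedness of an
equaliser in a Hausdorff space. -/
theorem isClosed_setOf_sigma_eq {ι : Type*} {X : ι → Type*} [∀ i, TopologicalSpace (X i)]
    [∀ i, T2Space (X i)] {W : Type*} [TopologicalSpace W] {p q : ι} (h : p = q) {F : W → X p}
    {G : W → X q} (hF : Continuous F) (hG : Continuous G) :
    IsClosed {w | (⟨p, F w⟩ : Σ i, X i) = ⟨q, G w⟩} := by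
  subst h
  simpa using isClosed_eq hF hG

/-! ### The multiplication on the fibres `X_n` and the fibre `X_0`. -/

namespace KGraph
open GraphMorphism Topology CompactlySupported ZeroAtInfty HilbertBimodule
variable {k : ℕ} {Λ : KGraph.{u, v} k} (hΛ : Λ.FinitelyAligned)

/-- The pre-Hilbert bimodule `C_c(∂Λ^{≥ n})`. -/
noncomputable abbrev boundaryPre (n : Fin k → ℕ) :
    PreHilbertBimodule C₀(Λ.Boundary, ℂ) C_c(Λ.BoundaryGE n, ℂ) :=
  graphPre (isLocalHomeomorph_sigma hΛ n) ⟨Subtype.val, continuous_subtype_val⟩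

/-- A closed property which holds on `C_c(∂Λ^{≥ n})` holds on `X_n`. -/
@[elab_as_elim]
theorem bimodule_induction {n : Fin k → ℕ} {p : Λ.bimodule hΛ n → Prop} (x : Λ.bimodule hΛ n)
    (hp : IsClosed {x | p x}) (h : ∀ f, p (Λ.toBimodule hΛ n f)) : p x :=
  ofPre_induction (boundaryPre hΛ n) x hp h

theorem left_toBimodule {n : Fin k → ℕ} (a : C₀(Λ.Boundary, ℂ)) (f : C_c(Λ.BoundaryGE n, ℂ)) :
    (Λ.bimodule hΛ n).str.left a (Λ.toBimodule hΛ n f)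
      = Λ.toBimodule hΛ n ((boundaryPre hΛ n).left a f) :=
  ofPre_left_mk (boundaryPre hΛ n) a f

theorem right_toBimodule {n : Fin k → ℕ} (a : C₀(Λ.Boundary, ℂ)) (f : C_c(Λ.BoundaryGE n, ℂ)) :
    (Λ.bimodule hΛ n).str.right a (Λ.toBimodule hΛ n f)
      = Λ.toBimodule hΛ n ((boundaryPre hΛ n).right a f) :=
  ofPre_right_mk (boundaryPre hΛ n) a f

theorem boundaryPre_inner_apply {n : Fin k → ℕ} (f g : C_c(Λ.BoundaryGE n, ℂ)) (z : Λ.Boundary) :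
    (boundaryPre hΛ n).inner f g z = fibreSum (sigma n) (fun y => star (f y) * g y) z := rfl

theorem boundaryPre_left_apply {n : Fin k → ℕ} (a : C₀(Λ.Boundary, ℂ))
    (f : C_c(Λ.BoundaryGE n, ℂ)) (x : Λ.BoundaryGE n) :
    (boundaryPre hΛ n).left a f x = a x.1 * f x := rfl

theorem boundaryPre_right_apply {n : Fin k → ℕ} (a : C₀(Λ.Boundary, ℂ))
    (f : C_c(Λ.BoundaryGE n, ℂ)) (x : Λ.BoundaryGE n) :
    (boundaryPre hΛ n).right a f x = a (sigma n x) * f x := rfl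

@[simp]
theorem piMap_apply {m n : Fin k → ℕ} (f : C_c(Λ.BoundaryGE m, ℂ)) (g : C_c(Λ.BoundaryGE n, ℂ))
    (x : Λ.BoundaryGE (m + n)) : piMap f g x = f (inclGE m n x) * g (sigmaGE m n x) := rfl

/-- Summing over the fibre of `σ_{m+n}` in two stages, the factor `conj g · g'` leaves the inner
sum, and what remains there is `⟨f, f'⟩(y)`. -/
theorem inner_piMap {m n : Fin k → ℕ} (f f' : C_c(Λ.BoundaryGE m, ℂ))
    (g g' : C_c(Λ.BoundaryGE n, ℂ)) :
    (boundaryPre hΛ (m + n)).inner (piMap f g) (piMap f' g')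
      = (boundaryPre hΛ n).inner g ((boundaryPre hΛ n).left ((boundaryPre hΛ m).inner f f') g') := by
  ext z
  refine (fibreSum_sigma_add hΛ m n (star (piMap f g) * piMap f' g') z).trans ?_
  rw [boundaryPre_inner_apply]
  congr 1
  funext y
  have h : (star (piMap f g) * piMap f' g' : C_c(Λ.BoundaryGE (m + n), ℂ))
      = fun x => (fun y => star (g y) * g' y) (sigmaGE m n x)
        * ((fun x => star (f x) * f' x) ∘ inclGE m n) x := by
    funext x
    simp only [CompactlySupportedContinuousMap.mul_apply,
      CompactlySupportedContinuousMap.star_apply, piMap_apply, star_mul', Function.comp]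
    ring
  rw [h]
  refine (fibreSum_mul_left (sigmaGE m n) ((fun x => star (f x) * f' x) ∘ inclGE m n)
    (fun y => star (g y) * g' y) y).trans ?_
  rw [fibreSum_sigmaGE, boundaryPre_left_apply, boundaryPre_inner_apply]
  ring

/-- The bilinear map `(f, g) ↦ f (g ∘ σ_m)` with values in `X_{m + n}`. -/
noncomputable def piBilin (m n : Fin k → ℕ) :
    C_c(Λ.BoundaryGE m, ℂ) →ₗ[ℂ] C_c(Λ.BoundaryGE n, ℂ) →ₗ[ℂ] Λ.bimodule hΛ (m + n) :=
  LinearMap.mk₂ ℂ (fun f g => Λ.toBimodule hΛ (m + n) (piMap f g))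
    (fun f f' g => by rw [← map_add]; congr 1; ext x; simp [add_mul])
    (fun c f g => by rw [← map_smul]; congr 1; ext x; simp [mul_assoc])
    (fun f g g' => by rw [← map_add]; congr 1; ext x; simp [mul_add])
    (fun c f g => by rw [← map_smul]; congr 1; ext x; simp [mul_left_comm])

/-- Besides the inner product formula, the right action is respected because `a ∘ σ_{m+n} = a ∘ σ_n
∘ σ_m`, and the left action because the inclusion `∂Λ^{≥ m+n} → ∂Λ^{≥ m}` leaves the underlying path
unchanged. -/
theorem exists_boundary_tensor_iso (m n : Fin k → ℕ) :
    ∃ M : Λ.bimodule hΛ m →L[ℂ] Λ.bimodule hΛ n →L[ℂ] Λ.bimodule hΛ (m + n),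
      (∀ f g, M (Λ.toBimodule hΛ m f) (Λ.toBimodule hΛ n g)
        = Λ.toBimodule hΛ (m + n) (piMap f g)) ∧
      ∃ Φ : Iso ((Λ.bimodule hΛ m).tensor (Λ.bimodule hΛ n)) (Λ.bimodule hΛ (m + n)),
        ∀ x y, Φ.toFun (tmul _ _ x y) = M x y := by
  refine exists_tensor_iso (boundaryPre hΛ m) (boundaryPre hΛ n) (Λ.bimodule hΛ (m + n))
    (piBilin hΛ m n) (fun f g f' g' => ?_) (fun f g a => ?_) (fun a f g => ?_) ?_
  · rw [← inner_piMap]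
    exact ofPre_inner_mk (boundaryPre hΛ (m + n)) _ _
  · refine Eq.trans ?_ (right_toBimodule hΛ a (piMap f g)).symm
    refine congrArg (Λ.toBimodule hΛ (m + n)) (DFunLike.ext _ _ fun x => ?_)
    rw [boundaryPre_right_apply, piMap_apply, piMap_apply, boundaryPre_right_apply,
      sigma_sigmaGE, mul_left_comm]
  · refine Eq.trans ?_ (left_toBimodule hΛ a (piMap f g)).symm
    refine congrArg (Λ.toBimodule hΛ (m + n)) (DFunLike.ext _ _ fun x => ?_)
    rw [boundaryPre_left_apply, piMap_apply, piMap_apply, boundaryPre_left_apply, mul_assoc]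
    rfl
  -- By surjectivity of `π` the products already exhaust the image of `C_c(∂Λ^{≥ m+n})`, so sums of
  -- products are not needed for density.
  · refine (denseRange_ofPreMk (boundaryPre hΛ (m + n))).mono ?_
    rintro _ ⟨h, rfl⟩
    obtain ⟨p, rfl⟩ := piMap_surjective hΛ m n h
    exact ⟨p, rfl⟩

theorem fibreSumC₀_sigma_zero_apply (f : C_c(Λ.BoundaryGE 0, ℂ)) (z : Λ.Boundary) :
    fibreSumC₀ (isLocalHomeomorph_sigma hΛ 0) f z = f ⟨z, le_zero z.1⟩ :=
  fibreSum_sigma_zero f z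

/-- The isomorphism is built from `X_0` to `A`, since `X_0` is the completion and maps out of it are
obtained by extension. Over one-point fibres `fibreSumC₀` is simply `f ↦ f`, already available as a
linear map into `C₀`. Its range is dense because `C_c` is dense in `C₀`. -/
theorem exists_iso_self :
    ∃ Ψ : Iso (Λ.bimodule hΛ 0) (HilbertBimodule.self C₀(Λ.Boundary, ℂ)),
      ∀ f, Ψ.toFun (Λ.toBimodule hΛ 0 f) = fibreSumC₀ (isLocalHomeomorph_sigma hΛ 0) f := by
  refine exists_iso_of_denseRange (boundaryPre hΛ 0) (HilbertBimodule.self C₀(Λ.Boundary, ℂ))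
    (fibreSumC₀ (isLocalHomeomorph_sigma hΛ 0)) (fun f g => ?_) (fun f a => ?_) (fun a f => ?_) ?_
  · change star (fibreSumC₀ (isLocalHomeomorph_sigma hΛ 0) f)
      * fibreSumC₀ (isLocalHomeomorph_sigma hΛ 0) g = _
    ext z
    rw [boundaryPre_inner_apply, fibreSum_sigma_zero, ZeroAtInftyContinuousMap.mul_apply,
      ZeroAtInftyContinuousMap.star_apply, fibreSumC₀_sigma_zero_apply hΛ,
      fibreSumC₀_sigma_zero_apply hΛ]
  · change _ = fibreSumC₀ (isLocalHomeomorph_sigma hΛ 0) f * a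
    ext z
    refine (fibreSumC₀_sigma_zero_apply hΛ _ z).trans ?_
    rw [ZeroAtInftyContinuousMap.mul_apply, fibreSumC₀_sigma_zero_apply hΛ,
      boundaryPre_right_apply, sigma_zero, mul_comm]
  · change _ = a * fibreSumC₀ (isLocalHomeomorph_sigma hΛ 0) f
    ext z
    refine (fibreSumC₀_sigma_zero_apply hΛ _ z).trans ?_
    rw [ZeroAtInftyContinuousMap.mul_apply, fibreSumC₀_sigma_zero_apply hΛ,
      boundaryPre_left_apply]
  · change DenseRange fun f => fibreSumC₀ (isLocalHomeomorph_sigma hΛ 0) f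
    refine Metric.denseRange_iff.mpr fun a ε hε => ?_
    obtain ⟨f, hf⟩ := a.exists_compactlySupported_approx (half_pos hε)
    -- The condition `d(x) ≥ 0` is vacuous, so compact supports transfer from `∂Λ` to the subtype
    -- `∂Λ^{≥ 0}`.
    have hval : IsClosedEmbedding (Subtype.val : Λ.BoundaryGE 0 → Λ.Boundary) :=
      IsClosedEmbedding.subtypeVal (by
        rw [show {x : Λ.Boundary | Le 0 x.1} = Set.univ from
          Set.eq_univ_of_forall fun x => le_zero x.1]
        exact isClosed_univ)
    let f' : C_c(Λ.BoundaryGE 0, ℂ) :=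
      { toFun := f ∘ Subtype.val
        continuous_toFun := f.continuous.comp continuous_subtype_val
        hasCompactSupport' := f.hasCompactSupport.comp_isClosedEmbedding hval }
    refine ⟨f', lt_of_le_of_lt ?_ (half_lt_self hε)⟩
    rw [← ZeroAtInftyContinuousMap.dist_toBCF_eq_dist,
      BoundedContinuousFunction.dist_le (half_pos hε).le]
    intro z
    rw [dist_eq_norm]
    refine Eq.trans_le ?_ (hf z)
    congr 2
    exact fibreSumC₀_sigma_zero_apply hΛ f' z

/-- Functions on `∂Λ^{≥ p}` and `∂Λ^{≥ q}` can be compared at a common underlying boundary path,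
which reduces each law to a pointwise identity without transport along `p = q`. -/
theorem toBimodule_sigma_eq {p q : Fin k → ℕ} (h : p = q) {f : C_c(Λ.BoundaryGE p, ℂ)}
    {g : C_c(Λ.BoundaryGE q, ℂ)}
    (hfg : ∀ (x : Λ.Boundary) (hp : Le p x.1) (hq : Le q x.1), f ⟨x, hp⟩ = g ⟨x, hq⟩) :
    (⟨p, Λ.toBimodule hΛ p f⟩ : Σ s, Λ.bimodule hΛ s) = ⟨q, Λ.toBimodule hΛ q g⟩ := by
  subst h
  rw [show f = g from DFunLike.ext _ _ fun x => hfg x.1 x.2 x.2]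

end KGraph

/-! ### Assembling the product system. -/

open KGraph HilbertBimodule in
theorem proposition3p5 {k : ℕ} (Λ : KGraph.{u, v} k) (hΛ : Λ.FinitelyAligned) :
    (∀ m n : Fin k → ℕ, Function.Surjective
      (fun fg : C_c(Λ.BoundaryGE m, ℂ) × C_c(Λ.BoundaryGE n, ℂ) => KGraph.piMap fg.1 fg.2)) ∧
    ∃ S : ProductSystem (Λ.bimodule hΛ),
      (∀ (m n : Fin k → ℕ) (f : C_c(Λ.BoundaryGE m, ℂ)) (g : C_c(Λ.BoundaryGE n, ℂ)),
        S.mul (Λ.toBimodule hΛ m f) (Λ.toBimodule hΛ n g)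
          = Λ.toBimodule hΛ (m + n) (KGraph.piMap f g)) ∧
      (∀ (a : C₀(Λ.Boundary, ℂ)) (f : C_c(Λ.BoundaryGE 0, ℂ)), (∀ x, f x = a x.1) →
        S.unit.toFun a = Λ.toBimodule hΛ 0 f) := by
  refine ⟨piMap_surjective hΛ, ?_⟩
  choose M hM hΦ using exists_boundary_tensor_iso hΛ
  obtain ⟨Ψ, hΨ⟩ := exists_iso_self hΛ
  have hΨc : Continuous Ψ.toLinearEquiv := Ψ.isometry.continuous
  have hΨs : ∀ y, Ψ.symm.toFun (Ψ.toFun y) = y := Ψ.toLinearEquiv.symm_apply_apply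
  have hsΨ : ∀ a, Ψ.toFun (Ψ.symm.toFun a) = a := Ψ.toLinearEquiv.apply_symm_apply
  -- The unit laws are stated for `y` in `X_0` acting through `Ψ y`, so that density of `C_c` in
  -- `X_0` applies; the substitution `y = Ψ⁻¹ a` comes at the end.
  have hleft : ∀ {p : Fin k → ℕ} (y : Λ.bimodule hΛ 0) (x : Λ.bimodule hΛ p),
      (⟨0 + p, M 0 p y x⟩ : Σ s, Λ.bimodule hΛ s)
        = ⟨p, (Λ.bimodule hΛ p).str.left (Ψ.toFun y) x⟩ := by
    intro p y x
    induction y using bimodule_induction hΛ with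
    | hp =>
      exact isClosed_setOf_sigma_eq (zero_add p) (by fun_prop)
        (continuous_left₂ _ hΨc continuous_const)
    | h f =>
    induction x using bimodule_induction hΛ with
    | hp =>
      exact isClosed_setOf_sigma_eq (zero_add p) (by fun_prop)
        (continuous_left _ _ continuous_id)
    | h g =>
      rw [hM, hΨ, left_toBimodule]
      refine toBimodule_sigma_eq hΛ (zero_add p) fun x hp hq => ?_
      rw [piMap_apply, boundaryPre_left_apply, fibreSumC₀_sigma_zero_apply hΛ]
      congr 2
      -- Only the second factor is shifted, and it is shifted by `0`.
      exact Subtype.ext (sigma_zero _)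
  have hright : ∀ {p : Fin k → ℕ} (x : Λ.bimodule hΛ p) (y : Λ.bimodule hΛ 0),
      (⟨p + 0, M p 0 x y⟩ : Σ s, Λ.bimodule hΛ s)
        = ⟨p, (Λ.bimodule hΛ p).str.right (Ψ.toFun y) x⟩ := by
    intro p x y
    induction y using bimodule_induction hΛ with
    | hp =>
      exact isClosed_setOf_sigma_eq (add_zero p) (by fun_prop)
        (continuous_right₂ _ hΨc continuous_const)
    | h f =>
    induction x using bimodule_induction hΛ with
    | hp =>
      exact isClosed_setOf_sigma_eq (add_zero p) (by fun_prop)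
        (continuous_right _ _ continuous_id)
    | h g =>
      rw [hM, hΨ, right_toBimodule]
      refine toBimodule_sigma_eq hΛ (add_zero p) fun x hp hq => ?_
      -- Here the factor from `X_0` is evaluated at `σ_p(x)`, which is exactly the right action.
      rw [piMap_apply, boundaryPre_right_apply, fibreSumC₀_sigma_zero_apply hΛ, mul_comm]
      rfl
  have hassoc : ∀ {p q r : Fin k → ℕ} (x : Λ.bimodule hΛ p) (y : Λ.bimodule hΛ q)
      (z : Λ.bimodule hΛ r), (⟨p + q + r, M _ _ (M _ _ x y) z⟩ : Σ s, Λ.bimodule hΛ s)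
        = ⟨p + (q + r), M _ _ x (M _ _ y z)⟩ := by
    intro p q r x y z
    have e := add_assoc p q r
    induction x using bimodule_induction hΛ with
    | hp => exact isClosed_setOf_sigma_eq e (by fun_prop) (by fun_prop)
    | h f =>
    induction y using bimodule_induction hΛ with
    | hp => exact isClosed_setOf_sigma_eq e (by fun_prop) (by fun_prop)
    | h g =>
    induction z using bimodule_induction hΛ with
    | hp => exact isClosed_setOf_sigma_eq e (by fun_prop) (by fun_prop)
    | h l =>
      rw [hM, hM, hM, hM]
      refine toBimodule_sigma_eq hΛ e fun x hp hq => ?_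
      rw [piMap_apply, piMap_apply, piMap_apply, piMap_apply, mul_assoc]
      congr 3
      -- The two triple products differ only in the argument of the last factor: `σ_{p+q}(x)`
      -- against `σ_q(σ_p(x))`.
      exact Subtype.ext (sigma_sigmaGE p q (inclGE (p + q) r ⟨x, hp⟩)).symm
  refine ⟨{ mul := fun {p q} x y => M p q x y
            mul_assoc := hassoc
            tensor_iso := hΦ
            unit := Ψ.symm
            unit_mul := fun a x => ?_
            mul_unit := fun x a => ?_ }, hM, fun a f hf => ?_⟩
  · exact (hleft _ x).trans (congrArg (fun b => (⟨_, (Λ.bimodule hΛ _).str.left b x⟩ :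
      Σ s, Λ.bimodule hΛ s)) (hsΨ a))
  · exact (hright x _).trans (congrArg (fun b => (⟨_, (Λ.bimodule hΛ _).str.right b x⟩ :
      Σ s, Λ.bimodule hΛ s)) (hsΨ a))
  -- As the unit is the inverse of `Ψ`, it is enough that `Ψ` sends the class of `f` back to `a`.
  · have ha : a = Ψ.toFun (Λ.toBimodule hΛ 0 f) := by
      rw [hΨ]
      ext z
      rw [fibreSumC₀_sigma_zero_apply hΛ, hf]
    change Ψ.symm.toFun a = _
    rw [ha, hΨs]
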